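/- An \emph{interior algebra} (S4-algebra) is a Boolean algebra $B$ with an operator $\Diamond:B\to B$ such that $\Diamond(a\vee b)=\Diamond a\vee\Diamond b$, $\Diamond\bot=\bot$, $a\wedge\Diamond a=a$ and $\Diamond\Diamond a=\Diamond a$; homomorphisms are Boolean homomorphisms preserving $\Diamond$. A \emph{profinite} interior algebra is a cofiltered limit of finite interior algebras, taken in the category of complete atomic interior algebras whose $\Diamond$ preserves arbitrary joins, with the homomorphisms preserving arbitrary joins and meets; the profinite interior algebras form a full subcategory ${\rm Pro}\,\mathbf{S4}_f$ of this category. The \emph{profinite completion} $A\to{\rm PrC}_{\mathbf{S4}}(A)$ of an interior algebra $A$ is the reflection of $A$ along the inclusion of ${\rm Pro}\,\mathbf{S4}_f$ into the category $\mathbf{S4}$ of interior algebras; it is computed as the inverse limit of the finite quotients of $A$, with the canonical map from $A$. For a reflexive and transitive relation $R$ on a set $P$, let $\Diamond_R S=\{p\in P\mid \exists q\in S,\ pRq\}$ for $S\subseteq P$, and let $\mathrm{cl}_R(p)=\{q\mid pRq \text{ and } qRp\}$ and $R(p)=\{q\mid pRq\}$. A set $G\subseteq P$ is a \emph{generated subframe}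 if $p\in G$ and $pRq$ imply $q\in G$. The \emph{height} of $p$ is the maximum cardinality of the chains $p=p_1Rp_2R\cdots Rp_k$ such that $p_{i+1}Rp_i$ fails for all $i$. Let $X$ be a set and let $F(X)$ be the free interior algebra on $X$. Define $v_n:(P_n,R_n)\to\mathcal P(X)$ inductively. Let $P_0=\emptyset$. Given $v_n$, let $P_n^+$ be the set of pairs $(Y,G)$ such that: (i) $Y$ is a nonempty finite subset of $\mathcal P(X)$ and $G$ is a finite generated subframe of $P_n$ which, if $n\ge 1$, contains at least one point of height $n$ (for $n=0$, $G=\emptyset$); (ii) if $G=R_n(p)$ for some $p\in P_n$, then $Y\nsubseteq v_n(\mathrm{cl}_{R_n}(p))$. Put \begin{align*} P_{n+1}&=P_n\cup\{(y,Y,G)\mid (Y,G)\in P_n^+,\ y\in Y\},\\ R_{n+1}&=R_n\cup\{\langle (y,Y,G),(y',Y,G)\rangle\mid (Y,G)\in P_n^+,\ y,y'\in Y\}\cup\{\langle (y,Y,G),q\rangle\mid (Y,G)\in P_n^+,\ y\in Y,\ q\in G\}, \end{align*} where the triples are new points, and let $v_{n+1}$ extend $v_n$ by $v_{n+1}(y,Y,G)=y$.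 \textbf{Theorem.} There is an isomorphism of interior algebras $$\mathrm{PrC}_{\mathbf{S4}}(F(X))\;\cong\;\Big\langle \mathcal P\Big(\bigcup_{n\ge0}P_n\Big),\ \Diamond_{\bigcup_n R_n}\Big\rangle .$$ More precisely, let $\eta$ be the homomorphism from $F(X)$ to the algebra on the right that sends each generator $x\in X$ to $\{p\mid x\in v(p)\}$, where $v=\bigcup_n v_n$. Then there is an isomorphism from the inverse limit of the finite quotients of $F(X)$ to the algebra on the right which carries the canonical map from $F(X)$ to $\eta$; and the algebra on the right is profinite, and $\eta$ has the universal property of the reflection of $F(X)$ into ${\rm Pro}\,\mathbf{S4}_f$. -/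

import Mathlib

open CategoryTheory CategoryTheory.Limits

universe u

namespace S4

/-! ### Modal algebras, interior algebras and their homomorphisms -/

/-- A modal algebra: a Boolean algebra with a finite-join preserving operator. -/
class ModalAlgebra (B : Type u) extends BooleanAlgebra B where
  dia : B → B
  dia_sup : ∀ a b : B, dia (a ⊔ b) = dia a ⊔ dia b
  dia_bot : dia ⊥ = ⊥

/-- The possibility operator. -/
prefix:75 "◇" => ModalAlgebra.dia

/-- An interior algebra (S4-algebra). -/
class InteriorAlgebra (B : Type u) extends ModalAlgebra B where
  inf_dia : ∀ a : B, a ⊓ ◇ a = a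
  dia_dia : ∀ a : B, ◇ (◇ a) = ◇ a

/-- Homomorphisms: Boolean homomorphisms (bounded lattice homomorphisms between Boolean
algebras) preserving `◇`. -/
structure AlgHom (A B : Type u) [InteriorAlgebra A] [InteriorAlgebra B]
    extends BoundedLatticeHom A B where
  map_dia : ∀ a : A, toFun (◇ a) = ◇ (toFun a)

/-- Objects of the category `S4` of interior algebras. -/
structure Alg where
  carrier : Type u
  [str : InteriorAlgebra carrier]

attribute [instance] Alg.str

instance : CoeSort Alg.{u} (Type u) := ⟨Alg.carrier⟩

theorem AlgHom.ext' {A B : Type u} [InteriorAlgebra A] [InteriorAlgebra B] {f g : AlgHom A B}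
    (h : ∀ a : A, f.toFun a = g.toFun a) : f = g := by
  obtain ⟨f, hf⟩ := f
  obtain ⟨g, hg⟩ := g
  have : f = g := DFunLike.ext f g h
  subst this
  rfl

/-- The category `S4` of interior algebras. -/
instance : Category Alg.{u} where
  Hom A B := AlgHom A B
  id A := { BoundedLatticeHom.id A with map_dia := fun _ => rfl }
  comp f g :=
    { g.toBoundedLatticeHom.comp f.toBoundedLatticeHom with
      map_dia := fun a => (congrArg g.toFun (f.map_dia a)).trans (g.map_dia (f.toFun a)) }

/-- The function underlying a morphism of `S4`. -/
def fn {A B : Alg.{u}} (f : A ⟶ B) : A → B := (AlgHom.toBoundedLatticeHom f).toFun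

theorem fn_id (A : Alg.{u}) : fn (𝟙 A) = id := rfl

theorem fn_comp {A B C : Alg.{u}} (f : A ⟶ B) (g : B ⟶ C) : fn (f ≫ g) = fn g ∘ fn f := rfl

theorem hom_ext {A B : Alg.{u}} {f g : A ⟶ B} (h : ∀ a, fn f a = fn g a) : f = g :=
  AlgHom.ext' h

/-! ### Constructing Boolean algebras from equations -/

/-- A Boolean algebra from the usual equations. -/
abbrev boolOfEqs (B : Type u) [Max B] [Min B] [Compl B] [Top B] [Bot B]
    (sup_comm : ∀ a b : B, a ⊔ b = b ⊔ a) (sup_assoc : ∀ a b c : B, a ⊔ b ⊔ c = a ⊔ (b ⊔ c))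
    (inf_comm : ∀ a b : B, a ⊓ b = b ⊓ a) (inf_assoc : ∀ a b c : B, a ⊓ b ⊓ c = a ⊓ (b ⊓ c))
    (sup_inf_self : ∀ a b : B, a ⊔ a ⊓ b = a) (inf_sup_self : ∀ a b : B, a ⊓ (a ⊔ b) = a)
    (sup_inf_left : ∀ a b c : B, a ⊔ b ⊓ c = (a ⊔ b) ⊓ (a ⊔ c))
    (sup_bot : ∀ a : B, a ⊔ ⊥ = a) (inf_top : ∀ a : B, a ⊓ ⊤ = a)
    (inf_compl : ∀ a : B, a ⊓ aᶜ = ⊥) (sup_compl : ∀ a : B, a ⊔ aᶜ = ⊤) : BooleanAlgebra B :=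
  letI L : Lattice B :=
    Lattice.mk' sup_comm sup_assoc inf_comm inf_assoc sup_inf_self inf_sup_self
  { L with
    le_sup_inf := fun a b c => le_of_eq (sup_inf_left a b c).symm
    compl := fun a => aᶜ
    top := ⊤
    bot := ⊥
    le_top := fun a => (inf_eq_left).1 (inf_top a)
    bot_le := fun a => (sup_eq_left).1 (sup_bot a)
    inf_compl_le_bot := fun a => le_of_eq (inf_compl a)
    top_le_sup_compl := fun a => le_of_eq (sup_compl a).symm }

/-! ### The free interior algebra on a set -/

/-- Modal terms (formulas) over the variables `X`. -/
inductive Term (X : Type u) : Type u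
  | var : X → Term X
  | bot : Term X
  | top : Term X
  | compl : Term X → Term X
  | sup : Term X → Term X → Term X
  | inf : Term X → Term X → Term X
  | dia : Term X → Term X

/-- Equational provability from the axioms of interior algebras: the congruence on terms generated
by all instances of these axioms. -/
inductive Term.Eqv {X : Type u} : Term X → Term X → Prop
  | refl (a) : Eqv a a
  | symm {a b} : Eqv a b → Eqv b a
  | trans {a b c} : Eqv a b → Eqv b c → Eqv a c
  | congr_compl {a b} : Eqv a b → Eqv (.compl a) (.compl b)
  | congr_sup {a b c d} : Eqv a b → Eqv c d → Eqv (.sup a c) (.sup b d)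
  | congr_inf {a b c d} : Eqv a b → Eqv c d → Eqv (.inf a c) (.inf b d)
  | congr_dia {a b} : Eqv a b → Eqv (.dia a) (.dia b)
  | sup_comm (a b) : Eqv (.sup a b) (.sup b a)
  | sup_assoc (a b c) : Eqv (.sup (.sup a b) c) (.sup a (.sup b c))
  | inf_comm (a b) : Eqv (.inf a b) (.inf b a)
  | inf_assoc (a b c) : Eqv (.inf (.inf a b) c) (.inf a (.inf b c))
  | sup_inf_self (a b) : Eqv (.sup a (.inf a b)) a
  | inf_sup_self (a b) : Eqv (.inf a (.sup a b)) a
  | sup_inf_left (a b c) : Eqv (.sup a (.inf b c)) (.inf (.sup a b) (.sup a c))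
  | sup_bot (a) : Eqv (.sup a .bot) a
  | inf_top (a) : Eqv (.inf a .top) a
  | inf_compl (a) : Eqv (.inf a (.compl a)) .bot
  | sup_compl (a) : Eqv (.sup a (.compl a)) .top
  | dia_sup (a b) : Eqv (.dia (.sup a b)) (.sup (.dia a) (.dia b))
  | dia_bot : Eqv (.dia .bot) .bot
  | inf_dia (a) : Eqv (.inf a (.dia a)) a
  | dia_dia (a) : Eqv (.dia (.dia a)) (.dia a)

/-- The setoid of provable equality. -/
def Term.setoid (X : Type u) : Setoid (Term X) := ⟨Term.Eqv, .refl, .symm, .trans⟩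

/-- The carrier of the free interior algebra: terms modulo provable equality. -/
def FreeCarrier (X : Type u) : Type u := Quotient (Term.setoid X)

namespace FreeCarrier

variable {X : Type u}

instance : Max (FreeCarrier X) :=
  ⟨Quotient.map₂ Term.sup fun _ _ h _ _ k => Term.Eqv.congr_sup h k⟩
instance : Min (FreeCarrier X) :=
  ⟨Quotient.map₂ Term.inf fun _ _ h _ _ k => Term.Eqv.congr_inf h k⟩
instance : Compl (FreeCarrier X) := ⟨Quotient.map Term.compl fun _ _ h => Term.Eqv.congr_compl h⟩
instance : Top (FreeCarrier X) := ⟨Quotient.mk _ Term.top⟩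
instance : Bot (FreeCarrier X) := ⟨Quotient.mk _ Term.bot⟩

instance : BooleanAlgebra (FreeCarrier X) :=
  boolOfEqs (FreeCarrier X)
    (by rintro ⟨a⟩ ⟨b⟩; exact Quotient.sound (.sup_comm a b))
    (by rintro ⟨a⟩ ⟨b⟩ ⟨c⟩; exact Quotient.sound (.sup_assoc a b c))
    (by rintro ⟨a⟩ ⟨b⟩; exact Quotient.sound (.inf_comm a b))
    (by rintro ⟨a⟩ ⟨b⟩ ⟨c⟩; exact Quotient.sound (.inf_assoc a b c))
    (by rintro ⟨a⟩ ⟨b⟩; exact Quotient.sound (.sup_inf_self a b))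
    (by rintro ⟨a⟩ ⟨b⟩; exact Quotient.sound (.inf_sup_self a b))
    (by rintro ⟨a⟩ ⟨b⟩ ⟨c⟩; exact Quotient.sound (.sup_inf_left a b c))
    (by rintro ⟨a⟩; exact Quotient.sound (.sup_bot a))
    (by rintro ⟨a⟩; exact Quotient.sound (.inf_top a))
    (by rintro ⟨a⟩; exact Quotient.sound (.inf_compl a))
    (by rintro ⟨a⟩; exact Quotient.sound (.sup_compl a))

instance : InteriorAlgebra (FreeCarrier X) where
  dia := Quotient.map Term.dia fun _ _ h => Term.Eqv.congr_dia h
  dia_sup := by rintro ⟨a⟩ ⟨b⟩; exact Quotient.sound (.dia_sup a b)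
  dia_bot := Quotient.sound .dia_bot
  inf_dia := by rintro ⟨a⟩; exact Quotient.sound (.inf_dia a)
  dia_dia := by rintro ⟨a⟩; exact Quotient.sound (.dia_dia a)

end FreeCarrier

/-- The free interior algebra `F(X)`. -/
def Free (X : Type u) : Alg.{u} := ⟨FreeCarrier X⟩

/-- The generators of `F(X)`. -/
def Free.of {X : Type u} (x : X) : Free X := Quotient.mk (Term.setoid X) (Term.var x)

/-- Evaluation of terms in an interior algebra. -/
def Term.eval {X : Type u} {B : Type u} [InteriorAlgebra B] (v : X → B) : Term X → B
  | .var x => v x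
  | .bot => ⊥
  | .top => ⊤
  | .compl a => (a.eval v)ᶜ
  | .sup a b => a.eval v ⊔ b.eval v
  | .inf a b => a.eval v ⊓ b.eval v
  | .dia a => ◇ (a.eval v)

theorem Term.Eqv.eval_eq {X : Type u} {B : Type u} [InteriorAlgebra B] (v : X → B)
    {a b : Term X} (h : Term.Eqv a b) : a.eval v = b.eval v := by
  induction h with
  | refl => rfl
  | symm _ ih => exact ih.symm
  | trans _ _ ih₁ ih₂ => exact ih₁.trans ih₂
  | congr_compl _ ih => simp only [Term.eval, ih]
  | congr_sup _ _ ih₁ ih₂ => simp only [Term.eval, ih₁, ih₂]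
  | congr_inf _ _ ih₁ ih₂ => simp only [Term.eval, ih₁, ih₂]
  | congr_dia _ ih => simp only [Term.eval, ih]
  | sup_comm => exact _root_.sup_comm _ _
  | sup_assoc => exact _root_.sup_assoc _ _ _
  | inf_comm => exact _root_.inf_comm _ _
  | inf_assoc => exact _root_.inf_assoc _ _ _
  | sup_inf_self => exact _root_.sup_inf_self
  | inf_sup_self => exact _root_.inf_sup_self
  | sup_inf_left => exact _root_.sup_inf_left _ _ _
  | sup_bot => exact sup_bot_eq _
  | inf_top => exact inf_top_eq _
  | inf_compl => exact inf_compl_self _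
  | sup_compl => exact sup_compl_eq_top
  | dia_sup => exact ModalAlgebra.dia_sup _ _
  | dia_bot => exact ModalAlgebra.dia_bot
  | inf_dia => exact InteriorAlgebra.inf_dia _
  | dia_dia => exact InteriorAlgebra.dia_dia _

/-- The homomorphism out of `F(X)` extending a function on the generators. -/
def Free.lift {X : Type u} {B : Alg.{u}} (v : X → B) : Free X ⟶ B :=
  AlgHom.mk
    { toFun := Quotient.lift (Term.eval v) fun _ _ h => Term.Eqv.eval_eq v h
      map_sup' := by rintro ⟨a⟩ ⟨b⟩; rfl
      map_inf' := by rintro ⟨a⟩ ⟨b⟩; rfl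
      map_top' := rfl
      map_bot' := rfl }
    (by rintro ⟨a⟩; rfl)

theorem Free.lift_of {X : Type u} {B : Alg.{u}} (v : X → B) (x : X) :
    fn (Free.lift v) (Free.of x) = v x := rfl

/-- Homomorphisms out of `F(X)` are determined on the generators, so that `F` is left adjoint to
the forgetful functor. -/
theorem Free.hom_ext {X : Type u} {B : Alg.{u}} (f g : Free X ⟶ B)
    (h : ∀ x, fn f (Free.of x) = fn g (Free.of x)) : f = g := by
  have aux : ∀ (k : Free X ⟶ B) (t : Term X),
      fn k (Quotient.mk (Term.setoid X) t) = t.eval (fun x => fn k (Free.of x)) := by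
    intro k t
    induction t with
    | var x => rfl
    | bot => exact (AlgHom.toBoundedLatticeHom k).map_bot'
    | top => exact (AlgHom.toBoundedLatticeHom k).map_top'
    | compl a ih =>
      let c : FreeCarrier X := Quotient.mk (Term.setoid X) a
      have h : fn k cᶜ = (fn k c)ᶜ :=
        map_compl' (α := (Free X).carrier) (AlgHom.toBoundedLatticeHom k) c
      exact h.trans (congrArg compl ih)
    | sup a b iha ihb =>
      exact ((AlgHom.toBoundedLatticeHom k).map_sup' _ _).trans (congrArg₂ (· ⊔ ·) iha ihb)
    | inf a b iha ihb =>
      exact ((AlgHom.toBoundedLatticeHom k).map_inf' _ _).trans (congrArg₂ (· ⊓ ·) iha ihb)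
    | dia a ih => exact (AlgHom.map_dia k _).trans (congrArg ModalAlgebra.dia ih)
  apply S4.hom_ext
  rintro ⟨t⟩
  exact (aux f t).trans ((congrArg (fun v => t.eval v) (funext h)).trans (aux g t).symm)

/-! ### The inverse limit of the finite quotients of an interior algebra -/

/-- Congruences of an interior algebra whose quotient is finite. Up to isomorphism these are the
surjective homomorphisms onto finite interior algebras. -/
structure FinCon (A : Alg.{u}) extends Setoid A where
  sup : ∀ {a b c d : A}, r a b → r c d → r (a ⊔ c) (b ⊔ d)
  inf : ∀ {a b c d : A}, r a b → r c d → r (a ⊓ c) (b ⊓ d)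
  compl : ∀ {a b : A}, r a b → r aᶜ bᶜ
  dia : ∀ {a b : A}, r a b → r (◇ a) (◇ b)
  finite : Finite (Quotient toSetoid)

namespace FinCon

variable {A : Alg.{u}} (θ : FinCon A)

/-- The quotient of `A` by the congruence. -/
def Quo : Type u := Quotient θ.toSetoid

/-- The class of an element. -/
def cls (a : A) : θ.Quo := Quotient.mk θ.toSetoid a

instance : Max θ.Quo := ⟨Quotient.map₂ (· ⊔ ·) fun _ _ h _ _ k => θ.sup h k⟩
instance : Min θ.Quo := ⟨Quotient.map₂ (· ⊓ ·) fun _ _ h _ _ k => θ.inf h k⟩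
instance : Compl θ.Quo := ⟨Quotient.map (·ᶜ) fun _ _ h => θ.compl h⟩
instance : Top θ.Quo := ⟨θ.cls ⊤⟩
instance : Bot θ.Quo := ⟨θ.cls ⊥⟩

instance : BooleanAlgebra θ.Quo :=
  boolOfEqs θ.Quo
    (by rintro ⟨a⟩ ⟨b⟩; exact congrArg θ.cls (sup_comm a b))
    (by rintro ⟨a⟩ ⟨b⟩ ⟨c⟩; exact congrArg θ.cls (sup_assoc a b c))
    (by rintro ⟨a⟩ ⟨b⟩; exact congrArg θ.cls (inf_comm a b))
    (by rintro ⟨a⟩ ⟨b⟩ ⟨c⟩; exact congrArg θ.cls (inf_assoc a b c))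
    (by rintro ⟨a⟩ ⟨b⟩; exact congrArg θ.cls sup_inf_self)
    (by rintro ⟨a⟩ ⟨b⟩; exact congrArg θ.cls inf_sup_self)
    (by rintro ⟨a⟩ ⟨b⟩ ⟨c⟩; exact congrArg θ.cls (sup_inf_left a b c))
    (by rintro ⟨a⟩; exact congrArg θ.cls (sup_bot_eq a))
    (by rintro ⟨a⟩; exact congrArg θ.cls (inf_top_eq a))
    (by rintro ⟨a⟩; exact congrArg θ.cls (inf_compl_self a))
    (by rintro ⟨a⟩; exact congrArg θ.cls sup_compl_eq_top)

instance : InteriorAlgebra θ.Quo where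
  dia := Quotient.map (ModalAlgebra.dia) fun _ _ h => θ.dia h
  dia_sup := by rintro ⟨a⟩ ⟨b⟩; exact congrArg θ.cls (ModalAlgebra.dia_sup a b)
  dia_bot := congrArg θ.cls ModalAlgebra.dia_bot
  inf_dia := by rintro ⟨a⟩; exact congrArg θ.cls (InteriorAlgebra.inf_dia a)
  dia_dia := by rintro ⟨a⟩; exact congrArg θ.cls (InteriorAlgebra.dia_dia a)

end FinCon

/-- The families of elements of the finite quotients of `A` compatible with the
projections `A / θ → A / ψ`, for `θ ⊆ ψ`. -/
structure PrCCarrier (A : Alg.{u}) : Type u where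
  val : ∀ θ : FinCon A, θ.Quo
  compat : ∀ θ ψ : FinCon A, (∀ a b : A, θ.r a b → ψ.r a b) →
    ∀ a : A, val θ = θ.cls a → val ψ = ψ.cls a

namespace PrCCarrier

variable {A : Alg.{u}}

protected theorem ext {f g : PrCCarrier A} (h : ∀ θ, f.val θ = g.val θ) : f = g := by
  obtain ⟨f, hf⟩ := f
  obtain ⟨g, hg⟩ := g
  obtain rfl : f = g := funext h
  rfl

instance : Max (PrCCarrier A) :=
  ⟨fun f g => ⟨fun θ => f.val θ ⊔ g.val θ, by
    intro θ ψ h a ha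
    obtain ⟨b, hb⟩ := Quotient.exists_rep (f.val θ)
    obtain ⟨c, hc⟩ := Quotient.exists_rep (g.val θ)
    rw [f.compat θ ψ h b hb.symm, g.compat θ ψ h c hc.symm]
    rw [← hb, ← hc] at ha
    exact Quotient.sound (h _ _ (Quotient.exact ha))⟩⟩

instance : Min (PrCCarrier A) :=
  ⟨fun f g => ⟨fun θ => f.val θ ⊓ g.val θ, by
    intro θ ψ h a ha
    obtain ⟨b, hb⟩ := Quotient.exists_rep (f.val θ)
    obtain ⟨c, hc⟩ := Quotient.exists_rep (g.val θ)
    rw [f.compat θ ψ h b hb.symm, g.compat θ ψ h c hc.symm]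
    rw [← hb, ← hc] at ha
    exact Quotient.sound (h _ _ (Quotient.exact ha))⟩⟩

instance : Compl (PrCCarrier A) :=
  ⟨fun f => ⟨fun θ => (f.val θ)ᶜ, by
    intro θ ψ h a ha
    obtain ⟨b, hb⟩ := Quotient.exists_rep (f.val θ)
    rw [f.compat θ ψ h b hb.symm]
    rw [← hb] at ha
    exact Quotient.sound (h _ _ (Quotient.exact ha))⟩⟩

/-- The family of classes of an element of `A`. -/
def ofElem (a : A) : PrCCarrier A :=
  ⟨fun θ => θ.cls a, fun _ _ h _ hb => Quotient.sound (h _ _ (Quotient.exact hb))⟩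

instance : Top (PrCCarrier A) := ⟨ofElem ⊤⟩
instance : Bot (PrCCarrier A) := ⟨ofElem ⊥⟩

instance : BooleanAlgebra (PrCCarrier A) :=
  boolOfEqs (PrCCarrier A)
    (fun _ _ => PrCCarrier.ext (fun _ => sup_comm _ _))
    (fun _ _ _ => PrCCarrier.ext (fun _ => sup_assoc _ _ _))
    (fun _ _ => PrCCarrier.ext (fun _ => inf_comm _ _))
    (fun _ _ _ => PrCCarrier.ext (fun _ => inf_assoc _ _ _))
    (fun _ _ => PrCCarrier.ext (fun _ => sup_inf_self))
    (fun _ _ => PrCCarrier.ext (fun _ => inf_sup_self))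
    (fun _ _ _ => PrCCarrier.ext (fun _ => sup_inf_left _ _ _))
    (fun _ => PrCCarrier.ext (fun _ => sup_bot_eq _))
    (fun _ => PrCCarrier.ext (fun _ => inf_top_eq _))
    (fun _ => PrCCarrier.ext (fun _ => inf_compl_self _))
    (fun _ => PrCCarrier.ext (fun _ => sup_compl_eq_top))

instance : InteriorAlgebra (PrCCarrier A) where
  dia f := ⟨fun θ => ◇ (f.val θ), by
    intro θ ψ h a ha
    obtain ⟨b, hb⟩ := Quotient.exists_rep (f.val θ)
    rw [f.compat θ ψ h b hb.symm]
    rw [← hb] at ha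
    exact Quotient.sound (h _ _ (Quotient.exact ha))⟩
  dia_sup _ _ := PrCCarrier.ext (fun _ => ModalAlgebra.dia_sup _ _)
  dia_bot := PrCCarrier.ext (fun _ => ModalAlgebra.dia_bot)
  inf_dia _ := PrCCarrier.ext (fun _ => InteriorAlgebra.inf_dia _)
  dia_dia _ := PrCCarrier.ext (fun _ => InteriorAlgebra.dia_dia _)

end PrCCarrier

/-- The profinite completion of `A`, computed as the inverse limit of the finite quotients
of `A`. -/
def PrC (A : Alg.{u}) : Alg.{u} := ⟨PrCCarrier A⟩

/-- The canonical homomorphism from `A` to its profinite completion. -/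
def PrC.unit (A : Alg.{u}) : A ⟶ PrC A :=
  AlgHom.mk
    { toFun := PrCCarrier.ofElem
      map_sup' := fun _ _ => rfl
      map_inf' := fun _ _ => rfl
      map_top' := rfl
      map_bot' := rfl }
    (fun _ => rfl)

/-! ### Profinite interior algebras and the universal property of the profinite completion -/

/-- Complete atomic interior algebras whose operator `◇` preserves arbitrary joins. -/
structure CAlg where
  alg : Alg.{u}
  complete : ∀ s : Set alg, ∃ a : alg, IsLUB s a
  atomic : IsAtomic alg
  additive : ∀ (s : Set alg) (a : alg), IsLUB s a →
    IsLUB ((ModalAlgebra.dia : alg → alg) '' s) (◇ a)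

/-- Preservation of all existing joins and meets. -/
def PreservesBounds {A B : Alg.{u}} (f : A ⟶ B) : Prop :=
  (∀ (s : Set A) (a : A), IsLUB s a → IsLUB (fn f '' s) (fn f a)) ∧
    ∀ (s : Set A) (a : A), IsGLB s a → IsGLB (fn f '' s) (fn f a)

/-- Complete atomic, completely additive interior algebras, with the homomorphisms that preserve
arbitrary joins and meets. -/
instance : Category CAlg.{u} where
  Hom A B := {f : A.alg ⟶ B.alg // PreservesBounds f}
  id A := ⟨𝟙 A.alg, by
    constructor <;> intro s a h <;>
    · rw [fn_id, Set.image_id]; exact h⟩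
  comp {A B C} f g := ⟨f.1 ≫ g.1, by
    constructor <;> intro s a h <;> rw [fn_comp, Set.image_comp]
    · exact g.2.1 _ _ (f.2.1 _ _ h)
    · exact g.2.2 _ _ (f.2.2 _ _ h)⟩

/-- The inclusion into the category of interior algebras. -/
def incl : CAlg.{u} ⥤ Alg.{u} where
  obj A := A.alg
  map f := f.1

/-- Profinite interior algebras: cofiltered limits, among the complete atomic completely additive
interior algebras, of finite interior algebras. (A finite interior algebra is complete, atomic and
completely additive, and every homomorphism between finite ones preserves all joins and meets.) -/
def CAlg.IsProfinite (B : CAlg.{u}) : Prop :=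
  ∃ (J : Type u) (_ : SmallCategory J) (_ : IsCofiltered J) (D : J ⥤ CAlg.{u}) (c : Cone D),
    (∀ j, Finite (D.obj j).alg) ∧ Nonempty (IsLimit c) ∧ Nonempty (c.pt ≅ B)

/-- `η : A ⟶ T` exhibits `T` as the value at `A` of the left adjoint to the inclusion of the
category of profinite interior algebras into the category of interior algebras. -/
def IsProfiniteReflection {A : Alg.{u}} {T : CAlg.{u}} (η : A ⟶ incl.obj T) : Prop :=
  T.IsProfinite ∧ ∀ B : CAlg.{u}, B.IsProfinite → ∀ h : A ⟶ incl.obj B,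
    ∃! g : T ⟶ B, η ≫ incl.map g = h

/-! ### Preordered Kripke frames and their complex algebras -/

/-- A reflexive and transitive Kripke frame. -/
structure Frame where
  carrier : Type u
  R : carrier → carrier → Prop
  refl : ∀ p, R p p
  trans : ∀ p q r, R p q → R q r → R p r

namespace Frame

variable (P : Frame.{u})

/-- The complex algebra of a frame: its powerset with `◇ S = {p | ∃ q ∈ S, p R q}`. -/
def complexAlg : Alg.{u} :=
  letI : InteriorAlgebra (Set P.carrier) :=
    { (inferInstance : BooleanAlgebra (Set P.carrier)) with
      dia := fun S => {p | ∃ q, P.R p q ∧ q ∈ S}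
      dia_sup := by
        intro a b; ext p; constructor
        · rintro ⟨q, hq, h | h⟩
          · exact Or.inl ⟨q, hq, h⟩
          · exact Or.inr ⟨q, hq, h⟩
        · rintro (⟨q, hq, h⟩ | ⟨q, hq, h⟩)
          · exact ⟨q, hq, Or.inl h⟩
          · exact ⟨q, hq, Or.inr h⟩
      dia_bot := by
        ext p; constructor
        · rintro ⟨q, _, h⟩; exact h
        · intro h; exact h.elim
      inf_dia := by
        intro a; ext p; constructor
        · rintro ⟨h, _⟩; exact h
        · intro h; exact ⟨h, p, P.refl p, h⟩
      dia_dia := by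
        intro a; ext p; constructor
        · rintro ⟨q, hq, r, hr, h⟩; exact ⟨r, P.trans _ _ _ hq hr, h⟩
        · rintro ⟨q, hq, h⟩; exact ⟨q, hq, q, P.refl q, h⟩ }
  ⟨Set P.carrier⟩

/-- The complex algebra, as a complete atomic completely additive interior algebra. -/
def complexCAlg : CAlg.{u} where
  alg := P.complexAlg
  complete := fun s => ⟨sSup (α := Set P.carrier) s, isLUB_sSup (α := Set P.carrier) s⟩
  atomic := (inferInstance : IsAtomic (Set P.carrier))
  additive := by
    intro s a h
    have ha : a = sSup (α := Set P.carrier) s := h.unique (isLUB_sSup (α := Set P.carrier) s)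
    subst ha
    constructor
    · rintro _ ⟨t, ht, rfl⟩ p ⟨q, hq, h'⟩
      exact ⟨q, hq, t, ht, h'⟩
    · rintro b hb p ⟨q, hq, t, ht, h'⟩
      exact hb ⟨t, ht, rfl⟩ ⟨q, hq, h'⟩

/-- The cluster of a point. -/
def cl (p : P.carrier) : Set P.carrier := {q | P.R p q ∧ P.R q p}

/-- `G` is (the underlying set of) a generated subframe. -/
def Generated (G : Set P.carrier) : Prop := ∀ p q, p ∈ G → P.R p q → q ∈ G

/-- The height of `p`: the supremum of the cardinalities of the chains
`p = p₁ R p₂ R ⋯ R pₖ` such that `pᵢ₊₁ R pᵢ` fails for all `i`. -/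
noncomputable def height (p : P.carrier) : ℕ∞ :=
  ⨆ (l : List P.carrier)
    (_ : List.IsChain (fun a b => P.R a b ∧ ¬ P.R b a) (p :: l)), ((p :: l).length : ℕ∞)

end Frame

/-! ### The universal model -/

/-- A frame with a valuation in the powerset of `X`. -/
structure Model (X : Type u) extends Frame.{u} where
  v : carrier → Set X

/-- The points `(y, Y, G)`, with `y ∈ Y`, to be added to the model `M` at stage `n + 1`. -/
@[ext]
structure NewPoint {X : Type u} (M : Model X) (n : ℕ) : Type u where
  y : Set X
  Y : Set (Set X)
  G : Set M.carrier
  mem : y ∈ Y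
  finite_Y : Y.Finite
  finite_G : G.Finite
  generated : M.Generated G
  height : n = 0 ∨ ∃ p ∈ G, M.height p = n
  irred : ∀ p, G = {q | M.R p q} → ¬ Y ⊆ M.v '' M.cl p

/-- The relation on the extended model. -/
def stepRel {X : Type u} (M : Model X) (n : ℕ) :
    M.carrier ⊕ NewPoint M n → M.carrier ⊕ NewPoint M n → Prop
  | .inl p, .inl q => M.R p q
  | .inl _, .inr _ => False
  | .inr s, .inl q => q ∈ s.G
  | .inr s, .inr t => s.Y = t.Y ∧ s.G = t.G

/-- The model obtained from `M` by adding all the new clusters of stage `n + 1`. -/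
def step {X : Type u} (M : Model X) (n : ℕ) : Model X where
  carrier := M.carrier ⊕ NewPoint M n
  R := stepRel M n
  refl := by
    rintro (p | s)
    · exact M.refl p
    · exact ⟨rfl, rfl⟩
  trans := by
    rintro (p | s) (q | t) (r | w) h k
    · exact M.trans _ _ _ h k
    · exact k
    · exact h.elim
    · exact h.elim
    · exact s.generated _ _ h k
    · exact k.elim
    · change r ∈ s.G
      rw [h.2]; exact k
    · exact ⟨h.1.trans k.1, h.2.trans k.2⟩
  v := Sum.elim M.v NewPoint.y

/-- The models `v_n : (P_n, R_n) → 𝒫(X)`. -/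
def stage (X : Type u) : ℕ → Model X
  | 0 => { carrier := PEmpty, R := fun _ _ => True, refl := fun p => p.elim,
           trans := fun p => p.elim, v := fun p => p.elim }
  | n + 1 => step (stage X n) n

/-- The points of the union of the increasing chain of the `P_n`, where `P_n` is identified with
its copy in `P_{n+1}`: since `P_0` is empty, a point of the union is a point added at a unique
stage `n + 1`. -/
def Points (X : Type u) : Type u := Σ n : ℕ, NewPoint (stage X n) n

/-- The inclusion of `P_n` in the union. It satisfies
`toPoints (n + 1) (Sum.inl p) = toPoints n p`. -/
def toPoints {X : Type u} : ∀ n : ℕ, (stage X n).carrier → Points X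
  | 0 => fun p => PEmpty.elim p
  | n + 1 => Sum.elim (toPoints n) (fun s => ⟨n, s⟩)

theorem toPoints_lt {X : Type u} (n : ℕ) (p : (stage X n).carrier) : (toPoints n p).1 < n := by
  induction n with
  | zero => exact PEmpty.elim p
  | succ n ih =>
    rcases p with p | s
    · exact (ih p).trans n.lt_succ_self
    · exact n.lt_succ_self

theorem toPoints_injective {X : Type u} (n : ℕ) :
    Function.Injective (toPoints (X := X) n) := by
  induction n with
  | zero => intro p; exact PEmpty.elim p
  | succ n ih =>
    rintro (p | s) (q | t) h
    · exact congrArg Sum.inl (ih h)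
    · have h1 := toPoints_lt n p
      have h2 : toPoints n p = ⟨n, t⟩ := h
      rw [h2] at h1
      exact absurd h1 (lt_irrefl _)
    · have h1 := toPoints_lt n q
      have h2 : ⟨n, s⟩ = toPoints n q := h
      rw [← h2] at h1
      exact absurd h1 (lt_irrefl _)
    · have h2 : (⟨n, s⟩ : Points X) = ⟨n, t⟩ := h
      exact congrArg Sum.inr (eq_of_heq (Sigma.mk.inj h2).2)

theorem exists_toPoints {X : Type u} (a : Points X) :
    ∃ (n : ℕ) (p : (stage X n).carrier), toPoints n p = a :=
  ⟨a.1 + 1, Sum.inr a.2, rfl⟩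

/-- The union of the relations `R_n`. -/
def unionRel {X : Type u} (a b : Points X) : Prop :=
  ∃ (n : ℕ) (p q : (stage X n).carrier), toPoints n p = a ∧ toPoints n q = b ∧ (stage X n).R p q

theorem exists_later {X : Type u} {n m : ℕ} (h : n ≤ m) (p q : (stage X n).carrier)
    (hR : (stage X n).R p q) : ∃ p' q' : (stage X m).carrier,
      toPoints m p' = toPoints n p ∧ toPoints m q' = toPoints n q ∧ (stage X m).R p' q' := by
  induction m, h using Nat.le_induction with
  | base => exact ⟨p, q, rfl, rfl, hR⟩
  | succ m _ ih =>
    obtain ⟨p', q', hp, hq, h'⟩ := ih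
    exact ⟨Sum.inl p', Sum.inl q', hp, hq, h'⟩

/-- The universal model over `X`: the union of the models `v_n : (P_n, R_n) → 𝒫(X)`. -/
def universalModel (X : Type u) : Model X where
  carrier := Points X
  R := unionRel
  refl := fun a => by
    obtain ⟨n, p, rfl⟩ := exists_toPoints a
    exact ⟨n, p, p, rfl, rfl, (stage X n).refl p⟩
  trans := by
    rintro _ _ _ ⟨n, p, q, rfl, rfl, h⟩ ⟨m, q', r, hq, rfl, k⟩
    obtain ⟨p₁, q₁, hp₁, hq₁, h₁⟩ := exists_later (le_max_left n m) p q h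
    obtain ⟨q₂, r₂, hq₂, hr₂, h₂⟩ := exists_later (le_max_right n m) q' r k
    have e : q₁ = q₂ := toPoints_injective _ (by rw [hq₁, hq₂, hq])
    subst e
    exact ⟨max n m, p₁, r₂, hp₁, hr₂, (stage X (max n m)).trans _ _ _ h₁ h₂⟩
  v := fun a => a.2.y

/-- The homomorphism from `F(X)` to the complex algebra of the universal model that sends a
generator `x` to `{p | x ∈ v p}`. -/
def toUniversal (X : Type u) : Free X ⟶ incl.obj (universalModel X).complexCAlg :=
  Free.lift (B := (universalModel X).complexAlg)
    (fun x => ({p | x ∈ (universalModel X).v p} : Set (universalModel X).carrier))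

end S4

namespace S4

/-! ### The structure of the universal model -/

section Universal

variable {X : Type u}

/-! Finite interior algebras are dual to finite preorders: a finite algebra `B` with a map `V : X →
B` is the same as a finite model on its atoms, and a homomorphism from a complex algebra to `B`
preserving all joins and meets is the same as a bounded morphism from the atoms of `B` into the
frame. The theorem thus rests on one fact: the universal model is terminal for finite models, that
is, each finite model has exactly one valuation-preserving bounded morphism into it
(`exists_boundedOn`, `BoundedOn.unique`).

For existence, a cluster of a finite model is placed once the points strictly above it are placed.
Let `Y` be its set of values and `G` the image of the points above. Either `G` is the up-set of a
point whose cluster already realises `Y`, and that cluster is reused, or `(Y, G)` is irreducible and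
the construction has added a cluster for it. For uniqueness, condition (ii) forbids that both
options be open.

Dually, every homomorphism from `F(X)` to a finite algebra extends along `η` to a unique
homomorphism preserving all joins and meets (`exists_hom`, `hom_unique`). Since every point sees
only finitely many points (`finite_unionRel`), the complex algebra is the limit of those of the
finite generated subframes, hence profinite; the universal property passes from finite algebras to
their limits. For the inverse limit, the extended projections to the finite quotients assemble into
a map. It is injective because every finite generated subframe is seen by some finite quotient, and
surjective because every extended projection depends on finitely many points only. -/

theorem stage_v (n : ℕ) (p : (stage X n).carrier) : (stage X n).v p = (toPoints n p).2.y := by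
  induction n with
  | zero => exact PEmpty.elim p
  | succ n ih =>
    rcases p with p | s
    · exact ih p
    · rfl

/-- Old points never see new ones, and new points see each other only within a cluster, so a strict
step from a new point lands in an earlier stage. -/
theorem idx_lt_of_rel {n : ℕ} {p q : (stage X n).carrier} (h : (stage X n).R p q)
    (h' : ¬ (stage X n).R q p) : (toPoints n q).1 < (toPoints n p).1 := by
  induction n with
  | zero => exact PEmpty.elim p
  | succ n ih =>
    rcases p with p | s <;> rcases q with q | t
    · exact ih h h'
    · exact h.elim
    · exact toPoints_lt n q
    · exact (h' ⟨h.1.symm, h.2.symm⟩).elim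

theorem length_chain_le {n : ℕ} (l : List (stage X n).carrier) (p : (stage X n).carrier)
    (hl : List.IsChain (fun a b => (stage X n).R a b ∧ ¬ (stage X n).R b a) (p :: l)) :
    (p :: l).length ≤ (toPoints n p).1 + 1 := by
  induction l generalizing p with
  | nil => simp
  | cons q l ih =>
    rw [List.isChain_cons_cons] at hl
    have h1 := ih q hl.2
    have h2 := idx_lt_of_rel hl.1.1 hl.1.2
    simp only [List.length_cons] at h1 ⊢
    omega

theorem height_eq_of_chain {n : ℕ} {p : (stage X n).carrier}
    (h : ∃ l, List.IsChain (fun a b => (stage X n).R a b ∧ ¬ (stage X n).R b a) (p :: l) ∧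
      (p :: l).length = (toPoints n p).1 + 1) :
    (stage X n).height p = ((toPoints n p).1 + 1 : ℕ) := by
  apply le_antisymm
  · exact iSup₂_le fun l hl => by exact_mod_cast length_chain_le l p hl
  · obtain ⟨l, hl, e⟩ := h
    exact le_iSup₂_of_le l hl (by rw [e])

/-- The requirement that `G` contain a point of height `n` makes the bound of `length_chain_le`
sharp: the new point is prepended to a longest chain from such a point. -/
theorem exists_chain (n : ℕ) (p : (stage X n).carrier) :
    ∃ l, List.IsChain (fun a b => (stage X n).R a b ∧ ¬ (stage X n).R b a) (p :: l) ∧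
      (p :: l).length = (toPoints n p).1 + 1 := by
  induction n with
  | zero => exact PEmpty.elim p
  | succ n ih =>
    have key : ∀ p : (stage X n).carrier, ∃ l : List (stage X (n + 1)).carrier,
        List.IsChain (fun a b => (stage X (n + 1)).R a b ∧ ¬ (stage X (n + 1)).R b a)
          (Sum.inl p :: l) ∧ (Sum.inl p :: l).length = (toPoints n p).1 + 1 := by
      intro p
      obtain ⟨l, hl, e⟩ := ih p
      refine ⟨l.map Sum.inl, ?_, (congrArg (· + 1) (List.length_map _)).trans e⟩
      exact (List.isChain_map (Sum.inl : _ → (stage X n).carrier ⊕ NewPoint (stage X n) n)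
        (R := fun a b => (stage X (n + 1)).R a b ∧ ¬ (stage X (n + 1)).R b a)
        (l := p :: l)).2 hl
    rcases p with p | s
    · exact key p
    · rcases s.height with h0 | ⟨q, hq, hh⟩
      · exact ⟨[], List.isChain_singleton _, by
          change 1 = n + 1
          rw [h0]⟩
      · rw [height_eq_of_chain (ih q)] at hh
        obtain ⟨l, hl, e⟩ := key q
        have hh' : (toPoints n q).1 + 1 = n := by exact_mod_cast hh
        refine ⟨Sum.inl q :: l, List.isChain_cons_cons.2 ⟨⟨hq, fun h => h⟩, hl⟩, ?_⟩
        exact (congrArg (· + 1) e).trans (congrArg (· + 1) hh')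

/-- Turns the height condition on new points into a condition on stage indices; the shift by one
arises because stage `n + 1` adds the points of index `n`. -/
theorem height_stage (n : ℕ) (p : (stage X n).carrier) :
    (stage X n).height p = ((toPoints n p).1 + 1 : ℕ) :=
  height_eq_of_chain (exists_chain n p)

/-! ### Description of the union without reference to stages -/

/-- The points strictly above the cluster of `a`. -/
def above (a : Points X) : Set (Points X) := toPoints a.1 '' a.2.G

theorem idx_lt_of_mem_above {a b : Points X} (h : b ∈ above a) : b.1 < a.1 := by
  obtain ⟨q, -, rfl⟩ := h
  exact toPoints_lt _ q

theorem idx_eq_zero_or (a : Points X) : a.1 = 0 ∨ ∃ b ∈ above a, b.1 + 1 = a.1 := by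
  rcases a.2.height with h | ⟨p, hp, h⟩
  · exact Or.inl h
  · rw [height_stage] at h
    exact Or.inr ⟨_, ⟨p, hp, rfl⟩, by exact_mod_cast h⟩

/-- The index is one more than the largest index in `above`, or zero when there is none. -/
theorem idx_eq_of_above_eq {a b : Points X} (h : above a = above b) : a.1 = b.1 := by
  have key : ∀ a b : Points X, above a = above b → a.1 ≤ b.1 := by
    intro a b h
    rcases idx_eq_zero_or a with h0 | ⟨c, hc, e⟩
    · omega
    · have := idx_lt_of_mem_above (h ▸ hc)
      omega
  exact le_antisymm (key a b h) (key b a h.symm)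

theorem points_ext {a b : Points X} (hy : a.2.y = b.2.y) (hY : a.2.Y = b.2.Y)
    (hG : above a = above b) : a = b := by
  have h := idx_eq_of_above_eq hG
  obtain ⟨n, s⟩ := a
  obtain ⟨m, t⟩ := b
  obtain rfl : n = m := h
  exact congrArg _ (NewPoint.ext hy hY ((toPoints_injective n).image_injective hG))

/-- The index is a function of `above`, so an old and a new point can never satisfy the second
alternative; this settles the mixed cases. -/
theorem stage_rel_iff {n : ℕ} (p q : (stage X n).carrier) :
    (stage X n).R p q ↔ toPoints n q ∈ above (toPoints n p) ∨
      ((toPoints n p).2.Y = (toPoints n q).2.Y ∧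
        above (toPoints n p) = above (toPoints n q)) := by
  induction n with
  | zero => exact PEmpty.elim p
  | succ n ih =>
    rcases p with p | s <;> rcases q with q | t
    · exact ih p q
    · refine iff_of_false (fun h => h) ?_
      have hp := toPoints_lt n p
      rintro (h | ⟨-, h⟩)
      · exact absurd (idx_lt_of_mem_above h) hp.not_gt
      · exact absurd (idx_eq_of_above_eq h) hp.ne
    · have hq := toPoints_lt n q
      constructor
      · exact fun h => Or.inl ⟨q, h, rfl⟩
      · rintro (h | ⟨-, h⟩)
        · exact ((toPoints_injective n).mem_set_image).1 h
        · exact absurd (idx_eq_of_above_eq h) hq.ne'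
    · constructor
      · exact fun h => Or.inr ⟨h.1, congrArg (Set.image (toPoints n)) h.2⟩
      · rintro (h | ⟨hY, h⟩)
        · exact absurd (idx_lt_of_mem_above h) (lt_irrefl _)
        · exact ⟨hY, (toPoints_injective n).image_injective h⟩

theorem exists_toPoints_of_lt {n : ℕ} {a : Points X} (h : a.1 < n) :
    ∃ p : (stage X n).carrier, toPoints n p = a := by
  obtain ⟨p, -, hp, -, -⟩ :=
    exists_later (X := X) (Nat.succ_le_of_lt h) (Sum.inr a.2) (Sum.inr a.2) (Frame.refl _ _)
  exact ⟨p, hp⟩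

theorem unionRel_iff (a b : Points X) :
    unionRel a b ↔ b ∈ above a ∨ (a.2.Y = b.2.Y ∧ above a = above b) := by
  constructor
  · rintro ⟨n, p, q, rfl, rfl, h⟩
    exact (stage_rel_iff p q).1 h
  · intro h
    obtain ⟨n, ha, hb⟩ : ∃ n, a.1 < n ∧ b.1 < n := ⟨a.1 + b.1 + 1, by omega, by omega⟩
    obtain ⟨p, rfl⟩ := exists_toPoints_of_lt ha
    obtain ⟨q, rfl⟩ := exists_toPoints_of_lt hb
    exact ⟨n, p, q, rfl, rfl, (stage_rel_iff p q).2 h⟩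

theorem unionRel_toPoints {n : ℕ} (p q : (stage X n).carrier) :
    unionRel (toPoints n p) (toPoints n q) ↔ (stage X n).R p q := by
  rw [unionRel_iff, stage_rel_iff]

theorem idx_le_of_unionRel {a b : Points X} (h : unionRel a b) : b.1 ≤ a.1 := by
  rcases (unionRel_iff a b).1 h with h | h
  · exact (idx_lt_of_mem_above h).le
  · exact (idx_eq_of_above_eq h.2).ge

theorem toPoints_image_rel {n : ℕ} (p : (stage X n).carrier) :
    toPoints n '' {q | (stage X n).R p q} = {b | unionRel (toPoints n p) b} := by
  ext b
  constructor
  · rintro ⟨q, hq, rfl⟩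
    exact (unionRel_toPoints p q).2 hq
  · intro h
    obtain ⟨q, rfl⟩ := exists_toPoints_of_lt ((idx_le_of_unionRel h).trans_lt (toPoints_lt n p))
    exact ⟨q, (unionRel_toPoints p q).1 h, rfl⟩

theorem stage_v_image_cl {n : ℕ} (p : (stage X n).carrier) :
    (stage X n).v '' (stage X n).cl p =
      (universalModel X).v '' (universalModel X).cl (toPoints n p) := by
  ext y
  constructor
  · rintro ⟨q, hq, rfl⟩
    exact ⟨toPoints n q, ⟨(unionRel_toPoints p q).2 hq.1, (unionRel_toPoints q p).2 hq.2⟩,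
      (stage_v n q).symm⟩
  · rintro ⟨b, ⟨h1, h2⟩, rfl⟩
    obtain ⟨q, rfl⟩ := exists_toPoints_of_lt ((idx_le_of_unionRel h1).trans_lt (toPoints_lt n p))
    exact ⟨q, ⟨(unionRel_toPoints p q).1 h1, (unionRel_toPoints q p).1 h2⟩, stage_v n q⟩

theorem above_finite (a : Points X) : (above a).Finite := a.2.finite_G.image _

theorem above_generated (a : Points X) : (universalModel X).Generated (above a) := by
  rintro _ b ⟨p, hp, rfl⟩ h
  have hb : b ∈ toPoints a.1 '' {q | (stage X a.1).R p q} := by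
    rw [toPoints_image_rel]; exact h
  obtain ⟨q, hq, rfl⟩ := hb
  exact ⟨q, a.2.generated p q hp hq, rfl⟩

theorem above_irred (a p : Points X) (h : above a = {q | unionRel p q}) :
    ¬ a.2.Y ⊆ (universalModel X).v '' (universalModel X).cl p := by
  have hp : p ∈ above a := by rw [h]; exact (universalModel X).refl p
  obtain ⟨p, -, rfl⟩ := hp
  rw [← stage_v_image_cl]
  apply a.2.irred
  rw [← toPoints_image_rel] at h
  exact (toPoints_injective _).image_injective h

/-- A point exists for all irreducible data `(y, Y, G)`. -/
theorem exists_point {y : Set X} {Y : Set (Set X)} {G : Set (Points X)} (hy : y ∈ Y)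
    (hY : Y.Finite) (hG : G.Finite) (hgen : (universalModel X).Generated G)
    (hirred : ∀ p, G = {q | unionRel p q} →
      ¬ Y ⊆ (universalModel X).v '' (universalModel X).cl p) :
    ∃ a : Points X, a.2.y = y ∧ a.2.Y = Y ∧ above a = G := by
  -- The stage is forced: one more than the largest index in `G`, or zero for empty `G`. It
  -- satisfies the height condition and has all of `G` available.
  obtain ⟨n, hn, hlt⟩ : ∃ n, (n = 0 ∨ ∃ b ∈ G, b.1 + 1 = n) ∧ ∀ b ∈ G, b.1 < n := by
    rcases G.eq_empty_or_nonempty with rfl | hne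
    · exact ⟨0, Or.inl rfl, by simp⟩
    · obtain ⟨b, hb, hmax⟩ := Set.exists_max_image G (fun b => b.1) hG hne
      exact ⟨b.1 + 1, Or.inr ⟨b, hb, rfl⟩, fun c hc => Nat.lt_succ_of_le (hmax c hc)⟩
  have him : toPoints n '' (toPoints n ⁻¹' G) = G :=
    Set.image_preimage_eq_of_subset fun b hb => exists_toPoints_of_lt (hlt b hb)
  refine ⟨⟨n, ⟨y, Y, toPoints n ⁻¹' G, hy, hY, hG.preimage (toPoints_injective n).injOn,
    ?_, ?_, ?_⟩⟩, rfl, rfl, him⟩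
  · exact fun p q hp h => hgen _ _ hp ((unionRel_toPoints p q).2 h)
  · refine hn.imp id ?_
    rintro ⟨b, hb, e⟩
    obtain ⟨p, rfl⟩ := exists_toPoints_of_lt (hlt b hb)
    exact ⟨p, hb, by rw [height_stage, e]⟩
  · intro p hp
    rw [stage_v_image_cl]
    apply hirred
    rw [← toPoints_image_rel, ← hp, him]

/-- By `points_ext`, the points of a cluster are separated by their values, which lie in the finite
set `Y`. -/
theorem finite_unionRel (a : Points X) : {b | unionRel a b}.Finite := by
  have hcl : {b : Points X | a.2.Y = b.2.Y ∧ above a = above b}.Finite := by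
    refine Set.Finite.of_finite_image (f := fun b : Points X => b.2.y)
      (a.2.finite_Y.subset ?_) ?_
    · rintro _ ⟨b, hb, rfl⟩
      exact hb.1 ▸ b.2.mem
    · exact fun b hb c hc h => points_ext h (hb.1.symm.trans hc.1) (hb.2.symm.trans hc.2)
  exact ((above_finite a).union hcl).subset fun b hb => (unionRel_iff a b).1 hb

end Universal

/-! ### Bounded morphisms from finite models to the universal model -/

section Terminal

variable {X : Type u}

/-- `f` preserves valuations and is a bounded morphism at all points of `D`. -/
structure BoundedOn (W : Model X) (D : Set W.carrier) (f : W.carrier → Points X) : Prop where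
  val : ∀ x ∈ D, (f x).2.y = W.v x
  forth : ∀ x ∈ D, ∀ y, W.R x y → unionRel (f x) (f y)
  back : ∀ x ∈ D, ∀ q, unionRel (f x) q → ∃ y, W.R x y ∧ f y = q

theorem unionRel_trans {a b c : Points X} (h : unionRel a b) (k : unionRel b c) :
    unionRel a c := (universalModel X).trans _ _ _ h k

theorem unionRel_refl (a : Points X) : unionRel a a := (universalModel X).refl a

theorem unionRel_of_mem_above {a b : Points X} (h : b ∈ above a) : unionRel a b :=
  (unionRel_iff a b).2 (Or.inl h)

theorem notMem_above_self (a : Points X) : a ∉ above a := fun h =>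
  lt_irrefl _ (idx_lt_of_mem_above h)

/-- If `b` were strictly above `a` and saw `a`, then `a` would lie in the generated set `above a`,
against the descent of indices. -/
theorem mem_cl_iff (a b : Points X) :
    b ∈ (universalModel X).cl a ↔ a.2.Y = b.2.Y ∧ above a = above b := by
  constructor
  · rintro ⟨h, k⟩
    rcases (unionRel_iff a b).1 h with h | h
    · exact (notMem_above_self a (above_generated a _ _ h k)).elim
    · exact h
  · rintro ⟨h, k⟩
    exact ⟨(unionRel_iff a b).2 (Or.inr ⟨h, k⟩),
      (unionRel_iff b a).2 (Or.inr ⟨h.symm, k.symm⟩)⟩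

/-- A finite set `Y` of values above a finite generated set `G` is realised within a cluster of the
universal model. -/
theorem exists_realization {Y : Set (Set X)} {G : Set (Points X)}
    (hY : Y.Finite) (hG : G.Finite) (hgen : (universalModel X).Generated G) :
    ∃ k : Set X → Points X, ∀ y ∈ Y, (k y).2.y = y ∧ (∀ z ∈ Y, unionRel (k y) (k z)) ∧
      (∀ g ∈ G, unionRel (k y) g) ∧ ∀ q, unionRel (k y) q → q ∈ G ∨ ∃ z ∈ Y, k z = q := by
  classical
  by_cases hred : ∃ p, G = {q | unionRel p q} ∧
      Y ⊆ (universalModel X).v '' (universalModel X).cl p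
  -- Reducible data: the cluster of `p` already carries all values in `Y`, and its points see
  -- exactly `G`.
  · obtain ⟨p, rfl, hp⟩ := hred
    have : Nonempty (Points X) := ⟨p⟩
    have hp' : ∀ y ∈ Y, ∃ q : Points X, q ∈ (universalModel X).cl p ∧ q.2.y = y := hp
    choose! k hk hv using hp'
    refine ⟨k, fun y hy => ⟨hv y hy, fun z hz => unionRel_trans (hk y hy).2 (hk z hz).1,
      fun g hg => unionRel_trans (hk y hy).2 hg, fun q hq =>
      Or.inl (unionRel_trans (hk y hy).1 hq)⟩⟩
  · push Not at hred
    have h : ∀ y ∈ Y, ∃ a : Points X, a.2.y = y ∧ a.2.Y = Y ∧ above a = G :=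
      fun y hy => exists_point hy hY hG hgen hred
    -- Serves only to give `choose!` a value outside `Y`. The witness has `Y = {∅}` above nothing,
    -- which is irreducible because no up-set of a point is empty.
    have : Nonempty (Points X) := by
      obtain ⟨a, -⟩ := exists_point (X := X) (y := ∅) (Y := {∅}) (G := ∅) rfl
        (Set.finite_singleton _) Set.finite_empty (fun _ _ h => h.elim) (fun p hp => by
          have : p ∈ (∅ : Set (Points X)) := by rw [hp]; exact unionRel_refl p
          exact this.elim)
      exact ⟨a⟩
    choose! k h1 h2 h3 using h
    refine ⟨k, fun y hy => ⟨h1 y hy, fun z hz => (unionRel_iff _ _).2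
      (Or.inr ⟨(h2 y hy).trans (h2 z hz).symm, (h3 y hy).trans (h3 z hz).symm⟩),
      fun g hg => unionRel_of_mem_above ((h3 y hy).symm ▸ hg), fun q hq => ?_⟩⟩
    rcases (unionRel_iff _ _).1 hq with h | ⟨hqY, hqG⟩
    · exact Or.inl (h3 y hy ▸ h)
    · have hm : q.2.y ∈ Y := by
        rw [← h2 y hy, hqY]; exact q.2.mem
      exact Or.inr ⟨q.2.y, hm, points_ext (h1 _ hm) ((h2 _ hm).trans ((h2 y hy).symm.trans hqY))
        ((h3 _ hm).trans ((h3 y hy).symm.trans hqG))⟩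

variable {W : Model X}

/-- The points strictly above the cluster of `w`. -/
def strictUp (W : Model X) (w : W.carrier) : Set W.carrier := {x | W.R w x ∧ ¬ W.R x w}

theorem BoundedOn.image_generated {D : Set W.carrier} {f : W.carrier → Points X}
    (hf : BoundedOn W D f) {E : Set W.carrier} (hE : W.Generated E) (hED : E ⊆ D) :
    (universalModel X).Generated (f '' E) := by
  rintro _ q ⟨d, hd, rfl⟩ h
  obtain ⟨e, he, rfl⟩ := hf.back d (hED hd) q h
  exact ⟨e, hE _ _ hd he, rfl⟩

theorem strictUp_generated (w : W.carrier) : W.Generated (strictUp W w) :=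
  fun _ _ hx hxy => ⟨W.trans _ _ _ hx.1 hxy, fun h => hx.2 (W.trans _ _ _ hxy h)⟩

/-- Induction on the size of `D`: a lowest cluster is removed, the rest is mapped by the induction
hypothesis, and `exists_realization` places the cluster below the image of its strict successors. -/
theorem exists_boundedOn [Finite W.carrier] (D : Set W.carrier) (hD : W.Generated D) :
    ∃ f, BoundedOn W D f := by
  classical
  induction hn : D.ncard using Nat.strong_induction_on generalizing D with
  | _ n ih =>
  subst hn
  rcases D.eq_empty_or_nonempty with rfl | hne
  · obtain ⟨k, -⟩ := exists_realization (X := X) (Y := ∅) (G := ∅) Set.finite_empty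
      Set.finite_empty (fun _ _ h => h.elim)
    exact ⟨fun _ => k ∅, by simp, by simp, by simp⟩
  -- A point of `D` with the largest up-set lies in a lowest cluster: any point of `D` seeing it has
  -- the same up-set, hence is seen back.
  obtain ⟨w, hw, hmax⟩ := Set.exists_max_image D (fun x => {y | W.R x y}.ncard) D.toFinite hne
  have hroot : ∀ x ∈ D, W.R x w → W.R w x := by
    intro x hx h
    have hsub : {y | W.R w y} ⊆ {y | W.R x y} := fun y hy => W.trans _ _ _ h hy
    have e := Set.eq_of_subset_of_ncard_le hsub (hmax x hx)
    have : x ∈ {y | W.R x y} := W.refl x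
    rwa [← e] at this
  have hD' : W.Generated {x ∈ D | ¬ W.R x w} := fun x y hx hxy =>
    ⟨hD _ _ hx.1 hxy, fun h => hx.2 (W.trans _ _ _ hxy h)⟩
  have hlt : {x ∈ D | ¬ W.R x w} ⊂ D :=
    ⟨Set.sep_subset _ _, fun h => (h hw).2 (W.refl w)⟩
  obtain ⟨f, hf⟩ := ih _ (Set.ncard_lt_ncard hlt) _ hD' rfl
  have hup : strictUp W w ⊆ {x ∈ D | ¬ W.R x w} := fun x hx => ⟨hD _ _ hw hx.1, hx.2⟩
  obtain ⟨k, hk⟩ := exists_realization (Y := W.v '' W.cl w) (G := f '' strictUp W w)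
    (Set.toFinite _) (Set.toFinite _) (hf.image_generated (strictUp_generated w) hup)
  have hin : ∀ x ∈ D, W.R x w → W.v x ∈ W.v '' W.cl w := fun x hx h =>
    ⟨x, ⟨hroot x hx h, h⟩, rfl⟩
  let F : W.carrier → Points X := fun x => if W.R x w then k (W.v x) else f x
  have hpos : ∀ {x}, W.R x w → F x = k (W.v x) := fun h => if_pos h
  have hneg : ∀ {x}, ¬ W.R x w → F x = f x := fun h => if_neg h
  refine ⟨F, ?_, ?_, ?_⟩
  · intro x hx
    by_cases h : W.R x w
    · rw [hpos h]
      exact (hk _ (hin x hx h)).1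
    · rw [hneg h]
      exact hf.val x ⟨hx, h⟩
  · intro x hx y hxy
    have hy := hD _ _ hx hxy
    by_cases h : W.R x w
    · rw [hpos h]
      by_cases h' : W.R y w
      · rw [hpos h']
        exact (hk _ (hin x hx h)).2.1 _ (hin y hy h')
      · rw [hneg h']
        exact (hk _ (hin x hx h)).2.2.1 _ ⟨y, ⟨W.trans _ _ _ (hroot x hx h) hxy, h'⟩, rfl⟩
    · have h' : ¬ W.R y w := fun h' => h (W.trans _ _ _ hxy h')
      rw [hneg h, hneg h']
      exact hf.forth x ⟨hx, h⟩ y hxy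
  · intro x hx q hq
    by_cases h : W.R x w
    · rw [hpos h] at hq
      rcases (hk _ (hin x hx h)).2.2.2 q hq with ⟨d, hd, rfl⟩ | ⟨_, ⟨c, hc, rfl⟩, rfl⟩
      · exact ⟨d, W.trans _ _ _ h hd.1, hneg hd.2⟩
      · exact ⟨c, W.trans _ _ _ h hc.1, hpos hc.2⟩
    · rw [hneg h] at hq
      obtain ⟨y, hxy, rfl⟩ := hf.back x ⟨hx, h⟩ q hq
      exact ⟨y, hxy, hneg fun h' => h (W.trans _ _ _ hxy h')⟩

/-- The split is whether `f w` is already the image of a point strictly above `w`. If so, the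
cluster of `w` collapses onto one realised above it; if not, the cluster of `f w` has exactly the
data of the cluster of `w`. -/
theorem BoundedOn.cluster_cases {f : W.carrier → Points X} (hf : BoundedOn W Set.univ f)
    (w : W.carrier) :
    (f '' strictUp W w = {q | unionRel (f w) q} ∧
      W.v '' W.cl w ⊆ (universalModel X).v '' (universalModel X).cl (f w)) ∨
    (above (f w) = f '' strictUp W w ∧ (f w).2.Y = W.v '' W.cl w) := by
  have hgen := hf.image_generated (strictUp_generated w) (Set.subset_univ _)
  have hcl : ∀ c ∈ W.cl w, f c ∈ (universalModel X).cl (f w) := fun c hc =>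
    ⟨hf.forth w trivial c hc.1, hf.forth c trivial w hc.2⟩
  by_cases h : f w ∈ f '' strictUp W w
  · left
    constructor
    · apply Set.Subset.antisymm
      · rintro _ ⟨d, hd, rfl⟩
        exact hf.forth w trivial d hd.1
      · exact fun q hq => hgen _ _ h hq
    · rintro _ ⟨c, hc, rfl⟩
      exact ⟨f c, hcl c hc, hf.val c trivial⟩
  · right
    have hab : above (f w) = f '' strictUp W w := by
      apply Set.Subset.antisymm
      · intro q hq
        obtain ⟨d, hd, rfl⟩ := hf.back w trivial q (unionRel_of_mem_above hq)
        refine ⟨d, ⟨hd, fun h' => notMem_above_self (f w) ?_⟩, rfl⟩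
        exact above_generated _ _ _ hq (hf.forth d trivial w h')
      · rintro _ ⟨d, hd, rfl⟩
        rcases (unionRel_iff _ _).1 (hf.forth w trivial d hd.1) with h' | h'
        · exact h'
        · exact (h (hgen _ _ ⟨d, hd, rfl⟩ ((mem_cl_iff _ _).2 h').2)).elim
    refine ⟨hab, Set.Subset.antisymm ?_ ?_⟩
    · intro y hy
      -- The data of `f w` with the value `y` give a point `b` of its cluster. By the back condition
      -- `b = f d`, and a `d` strictly above `w` would put `f d` in `above (f d)`.
      obtain ⟨b, rfl, hbY, hbG⟩ := exists_point hy (f w).2.finite_Y (above_finite (f w))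
        (above_generated (f w)) (above_irred (f w))
      obtain ⟨d, hd, rfl⟩ := hf.back w trivial b
        ((unionRel_iff _ _).2 (Or.inr ⟨hbY.symm, hbG.symm⟩))
      refine ⟨d, ⟨hd, ?_⟩, (hf.val d trivial).symm⟩
      by_contra h'
      apply notMem_above_self (f d)
      rw [hbG, hab]
      exact ⟨d, ⟨hd, h'⟩, rfl⟩
    · rintro _ ⟨c, hc, rfl⟩
      rw [((mem_cl_iff _ _).1 (hcl c hc)).1, ← hf.val c trivial]
      exact (f c).2.mem

/-- By induction on the size of the up-set, `f` and `g` agree strictly above `w`. In the mixed cases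
of the dichotomy one image would be a point with reducible data, against `above_irred`; in the other
two, cluster and value coincide. -/
theorem BoundedOn.unique [Finite W.carrier] {f g : W.carrier → Points X}
    (hf : BoundedOn W Set.univ f) (hg : BoundedOn W Set.univ g) : f = g := by
  funext w
  induction hn : {y | W.R w y}.ncard using Nat.strong_induction_on generalizing w with
  | _ n ih =>
  subst hn
  have hv : (f w).2.y = (g w).2.y := (hf.val w trivial).trans (hg.val w trivial).symm
  have him : f '' strictUp W w = g '' strictUp W w := by
    refine Set.image_congr fun d hd => ih _ (Set.ncard_lt_ncard ⟨?_, ?_⟩) d rfl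
    · exact fun y hy => W.trans _ _ _ hd.1 hy
    · exact fun h => hd.2 (h (W.refl w))
  rcases hf.cluster_cases w with ⟨f1, f2⟩ | ⟨f1, f2⟩ <;>
    rcases hg.cluster_cases w with ⟨g1, g2⟩ | ⟨g1, g2⟩
  · have e : {q | unionRel (f w) q} = {q | unionRel (g w) q} := by rw [← f1, ← g1, him]
    have h1 : g w ∈ {q | unionRel (f w) q} := by rw [e]; exact unionRel_refl _
    have h2 : f w ∈ {q | unionRel (g w) q} := by rw [← e]; exact unionRel_refl _
    obtain ⟨hY, hG⟩ := (mem_cl_iff (f w) (g w)).1 ⟨h1, h2⟩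
    exact points_ext hv hY hG
  · exact (above_irred (g w) (f w) (by rw [g1, ← him, f1]) (g2 ▸ f2)).elim
  · exact (above_irred (f w) (g w) (by rw [f1, him, g1]) (f2 ▸ g2)).elim
  · exact points_ext hv (f2.trans g2.symm) (by rw [f1, g1, him])

end Terminal

/-! ### Homomorphisms and finite interior algebras -/

section Finite

theorem dia_mono {B : Type u} [InteriorAlgebra B] {a b : B} (h : a ≤ b) : ◇ a ≤ ◇ b := by
  rw [← sup_eq_right.2 h, ModalAlgebra.dia_sup]
  exact le_sup_left

theorem le_dia {B : Type u} [InteriorAlgebra B] (a : B) : a ≤ ◇ a :=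
  inf_eq_left.1 (InteriorAlgebra.inf_dia a)

/-! ### Preservation properties of homomorphisms -/

section Hom

variable {A B : Alg.{u}} (f : A ⟶ B)

theorem fn_sup (a b : A) : fn f (a ⊔ b) = fn f a ⊔ fn f b :=
  (AlgHom.toBoundedLatticeHom f).map_sup' a b

theorem fn_inf (a b : A) : fn f (a ⊓ b) = fn f a ⊓ fn f b :=
  (AlgHom.toBoundedLatticeHom f).map_inf' a b

theorem fn_top : fn f ⊤ = ⊤ := (AlgHom.toBoundedLatticeHom f).map_top'

theorem fn_bot : fn f ⊥ = ⊥ := (AlgHom.toBoundedLatticeHom f).map_bot'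

theorem fn_compl (a : A) : fn f aᶜ = (fn f a)ᶜ :=
  map_compl' (AlgHom.toBoundedLatticeHom f) a

theorem fn_dia (a : A) : fn f (◇ a) = ◇ (fn f a) := AlgHom.map_dia f a

theorem fn_mono {a b : A} (h : a ≤ b) : fn f a ≤ fn f b := by
  rw [← inf_eq_left.2 h, fn_inf]
  exact inf_le_right

end Hom

/-- A homomorphism from its preservation of the operations. -/
def mkHom {A B : Alg.{u}} (f : A → B) (sup : ∀ a b, f (a ⊔ b) = f a ⊔ f b)
    (inf : ∀ a b, f (a ⊓ b) = f a ⊓ f b) (top : f ⊤ = ⊤) (bot : f ⊥ = ⊥)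
    (dia : ∀ a, f (◇ a) = ◇ (f a)) : A ⟶ B :=
  AlgHom.mk { toFun := f, map_sup' := sup, map_inf' := inf, map_top' := top, map_bot' := bot } dia

/-- Homomorphisms out of finite algebras preserve all joins and meets. -/
theorem preservesBounds_of_finite {A B : Alg.{u}} [Finite A] (f : A ⟶ B) : PreservesBounds f := by
  constructor
  · intro s a h
    refine ⟨?_, fun c hc => ?_⟩
    · rintro _ ⟨b, hb, rfl⟩
      exact fn_mono f (h.1 hb)
    -- A finite join of members of `s` bounds `s` and is sent below `c`; the least upper bound `a`
    -- lies below it.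
    · have key : ∀ t : Set A, t.Finite → t ⊆ s → ∃ b, b ∈ upperBounds t ∧ fn f b ≤ c := by
        intro t ht
        induction t, ht using Set.Finite.induction_on with
        | empty => exact fun _ => ⟨⊥, by simp, by rw [fn_bot]; exact bot_le⟩
        | @insert x t _ _ ih =>
          intro hts
          obtain ⟨b, hb, hbc⟩ := ih ((Set.subset_insert _ _).trans hts)
          refine ⟨x ⊔ b, ?_, ?_⟩
          · rintro y (rfl | hy)
            · exact le_sup_left
            · exact (hb hy).trans le_sup_right
          · rw [fn_sup]
            exact sup_le (hc ⟨x, hts (Set.mem_insert _ _), rfl⟩) hbc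
      obtain ⟨b, hb, hbc⟩ := key s s.toFinite subset_rfl
      exact (fn_mono f (h.2 hb)).trans hbc
  · intro s a h
    refine ⟨?_, fun c hc => ?_⟩
    · rintro _ ⟨b, hb, rfl⟩
      exact fn_mono f (h.1 hb)
    · have key : ∀ t : Set A, t.Finite → t ⊆ s → ∃ b, b ∈ lowerBounds t ∧ c ≤ fn f b := by
        intro t ht
        induction t, ht using Set.Finite.induction_on with
        | empty => exact fun _ => ⟨⊤, by simp, by rw [fn_top]; exact le_top⟩
        | @insert x t _ _ ih =>
          intro hts
          obtain ⟨b, hb, hbc⟩ := ih ((Set.subset_insert _ _).trans hts)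
          refine ⟨x ⊓ b, ?_, ?_⟩
          · rintro y (rfl | hy)
            · exact inf_le_left
            · exact inf_le_right.trans (hb hy)
          · rw [fn_inf]
            exact le_inf (hc ⟨x, hts (Set.mem_insert _ _), rfl⟩) hbc
      obtain ⟨b, hb, hbc⟩ := key s s.toFinite subset_rfl
      exact hbc.trans (fn_mono f (h.2 hb))

/-! ### Atoms of Boolean algebras -/

section Atoms

variable {B : Type u} [BooleanAlgebra B]

theorem atom_le_or_le_compl {a : B} (ha : IsAtom a) (b : B) : a ≤ b ∨ a ≤ bᶜ := by
  rw [le_compl_iff_disjoint_right]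
  exact or_iff_not_imp_left.2 fun h => (ha.not_le_iff_disjoint).1 h

theorem atom_not_le_compl {a b : B} (ha : IsAtom a) (h : a ≤ b) : ¬ a ≤ bᶜ := fun h' =>
  ha.1 (le_bot_iff.1 ((le_inf h h').trans (inf_compl_self b).le))

theorem atom_le_sup_iff {a : B} (ha : IsAtom a) {b c : B} : a ≤ b ⊔ c ↔ a ≤ b ∨ a ≤ c := by
  constructor
  · intro h
    by_contra! h'
    have h1 := (atom_le_or_le_compl ha b).resolve_left h'.1
    have h2 := (atom_le_or_le_compl ha c).resolve_left h'.2
    exact atom_not_le_compl ha h (by rw [compl_sup]; exact le_inf h1 h2)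
  · rintro (h | h)
    · exact h.trans le_sup_left
    · exact h.trans le_sup_right

theorem le_of_atoms [Finite B] {x y : B} (h : ∀ a, IsAtom a → a ≤ x → a ≤ y) : x ≤ y := by
  by_contra hxy
  obtain ⟨a, ha, hle⟩ := (eq_bot_or_exists_atom_le (x ⊓ yᶜ)).resolve_left fun e =>
    hxy (by rwa [← disjoint_iff, disjoint_compl_right_iff] at e)
  exact atom_not_le_compl ha (h a ha (hle.trans inf_le_left)) (hle.trans inf_le_right)

theorem eq_of_atoms [Finite B] {x y : B} (h : ∀ a, IsAtom a → (a ≤ x ↔ a ≤ y)) : x = y :=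
  le_antisymm (le_of_atoms fun a ha => (h a ha).1) (le_of_atoms fun a ha => (h a ha).2)

/-- In a finite Boolean algebra, every set of atoms is the set of atoms below some element. -/
theorem exists_atoms_le_iff [Finite B] (p : {a : B // IsAtom a} → Prop) :
    ∃ x : B, ∀ a : {a : B // IsAtom a}, a.1 ≤ x ↔ p a := by
  classical
  have := Fintype.ofFinite {a : B // IsAtom a}
  refine ⟨(Finset.univ.filter p).sup Subtype.val, fun a => ⟨fun h => ?_, fun h => ?_⟩⟩
  · by_contra hp
    refine atom_not_le_compl a.2 le_rfl (h.trans (Finset.sup_le fun b hb => ?_))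
    rw [le_compl_iff_disjoint_right]
    refine b.2.disjoint_of_ne a.2 fun e => hp ?_
    rw [← Subtype.ext e]
    exact (Finset.mem_filter.1 hb).2
  · exact Finset.le_sup (f := Subtype.val) (Finset.mem_filter.2 ⟨Finset.mem_univ _, h⟩)

end Atoms

/-- Atoms are join-prime and `◇` is additive, so one may split an atom off `b` and descend. This
makes `◇` on a finite algebra the operator of a relation on its atoms. -/
theorem exists_atom_of_le_dia {B : Type u} [InteriorAlgebra B] [Finite B] {a : B} (ha : IsAtom a)
    {b : B} (h : a ≤ ◇ b) : ∃ c, IsAtom c ∧ c ≤ b ∧ a ≤ ◇ c := by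
  induction b using WellFoundedLT.induction with
  | ind b ih =>
  rcases eq_bot_or_exists_atom_le b with rfl | ⟨c, hc, hcb⟩
  · rw [ModalAlgebra.dia_bot] at h
    exact (ha.1 (le_bot_iff.1 h)).elim
  · have e : c ⊔ b ⊓ cᶜ = b := by
      rw [sup_inf_left, sup_compl_eq_top, inf_top_eq, sup_eq_right.2 hcb]
    rw [← e, ModalAlgebra.dia_sup, atom_le_sup_iff ha] at h
    rcases h with h | h
    · exact ⟨c, hc, hcb, h⟩
    · have hlt : b ⊓ cᶜ < b := lt_of_le_of_ne inf_le_left fun e' =>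
        atom_not_le_compl hc le_rfl (hcb.trans (inf_eq_left.1 e'))
      obtain ⟨d, hd, hdb, had⟩ := ih _ hlt h
      exact ⟨d, hd, hdb.trans inf_le_left, had⟩

/-! ### Duality between finite algebras and bounded morphisms -/

variable {X : Type u}

/-- The model on the atoms of an interior algebra. -/
def atomModel {B : Alg.{u}} (v : X → B) : Model X where
  carrier := {a : B // IsAtom a}
  R a b := a.1 ≤ ◇ b.1
  refl a := le_dia a.1
  trans _ _ c h k := h.trans ((dia_mono k).trans (InteriorAlgebra.dia_dia c.1).le)
  v a := {x | a.1 ≤ v x}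

/-- The set of points underlying an element of a complex algebra. -/
def pts {P : Frame.{u}} (T : P.complexAlg) : Set P.carrier := T

theorem isLUB_complex {P : Frame.{u}} {s : Set P.complexAlg} {T : P.complexAlg} (h : IsLUB s T)
    (p : P.carrier) : p ∈ pts T ↔ ∃ S ∈ s, p ∈ pts S := by
  have e : pts T = sSup (α := Set P.carrier) s :=
    h.unique (isLUB_sSup (α := Set P.carrier) s)
  rw [e]
  exact Set.mem_sUnion

theorem isGLB_complex {P : Frame.{u}} {s : Set P.complexAlg} {T : P.complexAlg} (h : IsGLB s T)
    (p : P.carrier) : p ∈ pts T ↔ ∀ S ∈ s, p ∈ pts S := by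
  have e : pts T = sInf (α := Set P.carrier) s :=
    h.unique (isGLB_sInf (α := Set P.carrier) s)
  rw [e]
  exact Set.mem_sInter

theorem preservesBounds_of_atoms {P : Frame.{u}} {B : Alg.{u}} [Finite B] (g : P.complexAlg ⟶ B)
    (f : {a : B // IsAtom a} → P.carrier)
    (h : ∀ (T : P.complexAlg) a, a.1 ≤ fn g T ↔ f a ∈ pts T) :
    PreservesBounds g := by
  constructor
  · intro s T hT
    refine ⟨?_, fun c hc => le_of_atoms fun a ha hle => ?_⟩
    · rintro _ ⟨S, hS, rfl⟩
      exact fn_mono g (hT.1 hS)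
    · obtain ⟨S, hS, hm⟩ := (isLUB_complex hT _).1 ((h T ⟨a, ha⟩).1 hle)
      exact ((h S ⟨a, ha⟩).2 hm).trans (hc ⟨S, hS, rfl⟩)
  · intro s T hT
    refine ⟨?_, fun c hc => le_of_atoms fun a ha hle => ?_⟩
    · rintro _ ⟨S, hS, rfl⟩
      exact fn_mono g (hT.1 hS)
    · exact (h T ⟨a, ha⟩).2 ((isGLB_complex hT _).2 fun S hS =>
        (h S ⟨a, ha⟩).1 (hle.trans (hc ⟨S, hS, rfl⟩)))

/-- The map on atoms dual to a homomorphism preserving joins. -/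
theorem exists_dual {P : Frame.{u}} {B : Alg.{u}} (g : P.complexAlg ⟶ B)
    (hg : PreservesBounds g) : ∃ f : {a : B // IsAtom a} → P.carrier,
      ∀ (T : P.complexAlg) a, a.1 ≤ fn g T ↔ f a ∈ pts T := by
  have key : ∀ a : {a : B // IsAtom a}, ∃ p : P.carrier, a.1 ≤ fn g ({p} : Set P.carrier) := by
    intro a
    by_contra! h
    -- The whole frame is the join of its singletons. If `a` were below no image of a singleton,
    -- preservation of this join would give `⊤ ≤ aᶜ`.
    have hlub : IsLUB (α := P.complexAlg) (Set.range fun p : P.carrier => ({p} : Set P.carrier))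
        (Set.univ : Set P.carrier) :=
      ⟨fun _ _ => Set.subset_univ _, fun c hc p _ => hc ⟨p, rfl⟩ rfl⟩
    have h1 : fn g (Set.univ : Set P.carrier) ≤ a.1ᶜ := by
      apply (hg.1 _ _ hlub).2
      rintro _ ⟨_, ⟨p, rfl⟩, rfl⟩
      have := (atom_le_or_le_compl a.2 _).resolve_left (h p)
      exact le_compl_comm.1 this
    have h2 : fn g (Set.univ : Set P.carrier) = ⊤ := fn_top g
    rw [h2] at h1
    exact atom_not_le_compl a.2 le_rfl (le_top.trans h1)
  choose f hf using key
  refine ⟨f, fun T a => ⟨fun h => ?_, fun h => ?_⟩⟩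
  · by_contra hn
    have hsub : ({f a} : Set P.carrier) ≤ (pts T)ᶜ := by
      rintro _ rfl
      exact hn
    have h1 : a.1 ≤ fn g Tᶜ := (hf a).trans (fn_mono g hsub)
    rw [fn_compl] at h1
    exact atom_not_le_compl a.2 h h1
  · have hsub : ({f a} : Set P.carrier) ≤ (T : Set P.carrier) := by
      rintro _ rfl
      exact h
    exact (hf a).trans (fn_mono g hsub)

/-- The dual maps of `g` and `g'` are bounded morphisms from the same finite model on the atoms of
`B`, so `BoundedOn.unique` identifies them. The forth and back conditions come from preservation of
`◇` on singletons. -/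
theorem extension_unique {B : Alg.{u}} [Finite B] {g g' : (universalModel X).complexAlg ⟶ B}
    (hg : PreservesBounds g) (hg' : PreservesBounds g')
    (h : ∀ x : X, fn g ({p | x ∈ (universalModel X).v p} : Set (Points X)) =
      fn g' ({p | x ∈ (universalModel X).v p} : Set (Points X))) : g = g' := by
  let V : X → B := fun x => fn g ({p | x ∈ (universalModel X).v p} : Set (Points X))
  have key : ∀ k : (universalModel X).complexAlg ⟶ B,
      (∀ x : X, V x = fn k ({p | x ∈ (universalModel X).v p} : Set (Points X))) →
      ∀ f : {a : B // IsAtom a} → Points X,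
      (∀ (T : (universalModel X).complexAlg) a, a.1 ≤ fn k T ↔ f a ∈ pts T) →
      BoundedOn (atomModel V) Set.univ f := by
    intro k hV f hf
    refine ⟨fun a _ => ?_, fun a _ b hab => ?_, fun a _ q hq => ?_⟩
    · ext x
      change _ ↔ a.1 ≤ V x
      rw [hV]
      exact (hf ({p | x ∈ (universalModel X).v p} : Set (Points X)) a).symm
    · have h1 : b.1 ≤ fn k ({f b} : Set (Points X)) := (hf _ b).2 rfl
      have h2 : a.1 ≤ fn k (◇ (show (universalModel X).complexAlg from
          ({f b} : Set (Points X)))) := by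
        rw [fn_dia]
        exact le_trans hab (dia_mono h1)
      obtain ⟨_, hr, rfl⟩ := (hf _ a).1 h2
      exact hr
    · have h2 : a.1 ≤ fn k (◇ (show (universalModel X).complexAlg from
          ({q} : Set (Points X)))) := (hf _ a).2 ⟨q, hq, rfl⟩
      rw [fn_dia] at h2
      obtain ⟨b, hb, hbq, hab⟩ := exists_atom_of_le_dia a.2 h2
      exact ⟨⟨b, hb⟩, hab, (hf _ ⟨b, hb⟩).1 hbq⟩
  obtain ⟨f, hf⟩ := exists_dual g hg
  obtain ⟨f', hf'⟩ := exists_dual g' hg'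
  have : Finite (atomModel V).carrier := inferInstanceAs (Finite {a : B // IsAtom a})
  obtain rfl : f = f' := (key g (fun _ => rfl) f hf).unique (key g' h f' hf')
  refine hom_ext fun T => eq_of_atoms fun a ha => ?_
  rw [hf T ⟨a, ha⟩, hf' T ⟨a, ha⟩]

/-- The required `g` is dual to the bounded morphism from the atom model. The set `S` is the image
of that morphism; it records that `g` depends on finitely many points only, which surjectivity onto
the inverse limit needs. -/
theorem exists_extension {B : Alg.{u}} [Finite B] (V : X → B) :
    ∃ g : (universalModel X).complexAlg ⟶ B, PreservesBounds g ∧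
      (∀ x : X, fn g ({p | x ∈ (universalModel X).v p} : Set (Points X)) = V x) ∧
      ∃ S : Set (Points X), S.Finite ∧ (universalModel X).Generated S ∧ fn g S = ⊤ := by
  have : Finite (atomModel V).carrier := inferInstanceAs (Finite {a : B // IsAtom a})
  obtain ⟨f, hf⟩ := exists_boundedOn (W := atomModel V) Set.univ (fun _ _ _ _ => trivial)
  choose G hG using fun T : (universalModel X).complexAlg =>
    exists_atoms_le_iff (B := B) fun a => f a ∈ pts T
  have hG' : ∀ T a (ha : IsAtom a), a ≤ G T ↔ f ⟨a, ha⟩ ∈ pts T := fun T a ha => hG T ⟨a, ha⟩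
  let g : (universalModel X).complexAlg ⟶ B := mkHom G
    (fun S T => eq_of_atoms fun a ha => by
      rw [atom_le_sup_iff ha, hG' _ _ ha, hG' _ _ ha, hG' _ _ ha]; exact Iff.rfl)
    (fun S T => eq_of_atoms fun a ha => by
      rw [le_inf_iff, hG' _ _ ha, hG' _ _ ha, hG' _ _ ha]; exact Iff.rfl)
    (eq_of_atoms fun a ha => by rw [hG' _ _ ha]; exact iff_of_true trivial le_top)
    (eq_of_atoms fun a ha => by
      rw [hG' _ _ ha]; exact iff_of_false (fun h => h) fun h => ha.1 (le_bot_iff.1 h))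
    (fun T => eq_of_atoms fun a ha => by
      rw [hG' _ _ ha]
      constructor
      · rintro ⟨q, hq, hqT⟩
        obtain ⟨b, hab, rfl⟩ := hf.back ⟨a, ha⟩ trivial q hq
        exact le_trans hab (dia_mono ((hG T b).2 hqT))
      · intro h
        obtain ⟨b, hb, hbT, hab⟩ := exists_atom_of_le_dia ha h
        exact ⟨f ⟨b, hb⟩, hf.forth ⟨a, ha⟩ trivial ⟨b, hb⟩ hab, (hG' T b hb).1 hbT⟩)
  refine ⟨g, preservesBounds_of_atoms g f hG, fun x => eq_of_atoms fun a ha => ?_,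
    f '' Set.univ, Set.toFinite _, hf.image_generated (fun _ _ _ _ => trivial) subset_rfl,
    eq_of_atoms fun a ha => iff_of_true ((hG' _ a ha).2 ⟨_, trivial, rfl⟩) le_top⟩
  refine (hG' _ a ha).trans ?_
  change x ∈ (f ⟨a, ha⟩).2.y ↔ _
  rw [hf.val ⟨a, ha⟩ trivial]
  exact Iff.rfl

end Finite

/-! ### Concrete limits of complete atomic interior algebras -/

section Sections

variable {J : Type u} [SmallCategory J] (D : J ⥤ CAlg.{u})

/-- Compatible families of elements of a diagram of algebras. -/
structure Sec : Type u where
  val : ∀ j, (D.obj j).alg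
  compat : ∀ {i j : J} (f : i ⟶ j), fn (D.map f).1 (val i) = val j

namespace Sec

variable {D}

protected theorem ext {s t : Sec D} (h : ∀ j, s.val j = t.val j) : s = t := by
  obtain ⟨s, hs⟩ := s
  obtain ⟨t, ht⟩ := t
  obtain rfl : s = t := funext h
  rfl

instance : Max (Sec D) :=
  ⟨fun s t => ⟨fun j => s.val j ⊔ t.val j, fun f => by rw [fn_sup, s.compat, t.compat]⟩⟩

instance : Min (Sec D) :=
  ⟨fun s t => ⟨fun j => s.val j ⊓ t.val j, fun f => by rw [fn_inf, s.compat, t.compat]⟩⟩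

instance : Compl (Sec D) :=
  ⟨fun s => ⟨fun j => (s.val j)ᶜ, fun f => by rw [fn_compl, s.compat]⟩⟩

instance : Top (Sec D) := ⟨⟨fun _ => ⊤, fun _ => fn_top _⟩⟩
instance : Bot (Sec D) := ⟨⟨fun _ => ⊥, fun _ => fn_bot _⟩⟩

instance : BooleanAlgebra (Sec D) :=
  boolOfEqs (Sec D)
    (fun _ _ => Sec.ext (fun _ => sup_comm _ _))
    (fun _ _ _ => Sec.ext (fun _ => sup_assoc _ _ _))
    (fun _ _ => Sec.ext (fun _ => inf_comm _ _))
    (fun _ _ _ => Sec.ext (fun _ => inf_assoc _ _ _))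
    (fun _ _ => Sec.ext (fun _ => sup_inf_self))
    (fun _ _ => Sec.ext (fun _ => inf_sup_self))
    (fun _ _ _ => Sec.ext (fun _ => sup_inf_left _ _ _))
    (fun _ => Sec.ext (fun _ => sup_bot_eq _))
    (fun _ => Sec.ext (fun _ => inf_top_eq _))
    (fun _ => Sec.ext (fun _ => inf_compl_self _))
    (fun _ => Sec.ext (fun _ => sup_compl_eq_top))

instance : InteriorAlgebra (Sec D) where
  dia s := ⟨fun j => ◇ (s.val j), fun f => by rw [fn_dia, s.compat]⟩
  dia_sup _ _ := Sec.ext (fun _ => ModalAlgebra.dia_sup _ _)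
  dia_bot := Sec.ext (fun _ => ModalAlgebra.dia_bot)
  inf_dia _ := Sec.ext (fun _ => InteriorAlgebra.inf_dia _)
  dia_dia _ := Sec.ext (fun _ => InteriorAlgebra.dia_dia _)

theorem le_iff {s t : Sec D} : s ≤ t ↔ ∀ j, s.val j ≤ t.val j := by
  rw [← sup_eq_right]
  constructor
  · intro h j
    rw [← sup_eq_right]
    exact congrArg (fun r : Sec D => r.val j) h
  · exact fun h => Sec.ext fun j => sup_eq_right.2 (h j)

theorem image_compat (S : Set (Sec D)) {i j : J} (f : i ⟶ j) :
    fn (D.map f).1 '' ((fun r : Sec D => r.val i) '' S) = (fun r : Sec D => r.val j) '' S := by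
  rw [Set.image_image]
  exact Set.image_congr fun s _ => s.compat f

/-- Transition maps preserve joins, so the componentwise joins form a compatible family. -/
theorem exists_isLUB (S : Set (Sec D)) :
    ∃ s, IsLUB S s ∧ ∀ j, IsLUB ((fun r : Sec D => r.val j) '' S) (s.val j) := by
  choose a ha using fun j => (D.obj j).complete ((fun r : Sec D => r.val j) '' S)
  refine ⟨⟨a, fun {i j} f => ?_⟩, ⟨fun t ht => le_iff.2 fun j => (ha j).1 ⟨t, ht, rfl⟩,
    fun t ht => le_iff.2 fun j => (ha j).2 ?_⟩, ha⟩
  · have h := (D.map f).2.1 _ _ (ha i)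
    rw [image_compat] at h
    exact h.unique (ha j)
  · rintro _ ⟨r, hr, rfl⟩
    exact le_iff.1 (ht hr) j

theorem exists_isGLB (S : Set (Sec D)) :
    ∃ s, IsGLB S s ∧ ∀ j, IsGLB ((fun r : Sec D => r.val j) '' S) (s.val j) := by
  have hex : ∀ j, ∃ a, IsGLB ((fun r : Sec D => r.val j) '' S) a := fun j =>
    ((D.obj j).complete _).imp fun _ h => isLUB_lowerBounds.1 h
  choose a ha using hex
  refine ⟨⟨a, fun {i j} f => ?_⟩, ⟨fun t ht => le_iff.2 fun j => (ha j).1 ⟨t, ht, rfl⟩,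
    fun t ht => le_iff.2 fun j => (ha j).2 ?_⟩, ha⟩
  · have h := (D.map f).2.2 _ _ (ha i)
    rw [image_compat] at h
    exact h.unique (ha j)
  · rintro _ ⟨r, hr, rfl⟩
    exact le_iff.1 (ht hr) j

theorem isLUB_val {S : Set (Sec D)} {s : Sec D} (h : IsLUB S s) (j : J) :
    IsLUB ((fun r : Sec D => r.val j) '' S) (s.val j) := by
  obtain ⟨t, ht, ht'⟩ := exists_isLUB S
  obtain rfl := h.unique ht
  exact ht' j

theorem isGLB_val {S : Set (Sec D)} {s : Sec D} (h : IsGLB S s) (j : J) :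
    IsGLB ((fun r : Sec D => r.val j) '' S) (s.val j) := by
  obtain ⟨t, ht, ht'⟩ := exists_isGLB S
  obtain rfl := h.unique ht
  exact ht' j

theorem exists_atom_le {s : Sec D} (hs : s ≠ ⊥) : ∃ t, IsAtom t ∧ t ≤ s := by
  obtain ⟨j, hj⟩ : ∃ j, s.val j ≠ ⊥ := by
    by_contra! h
    exact hs (Sec.ext h)
  have := (D.obj j).atomic
  obtain ⟨a, ha, has⟩ := (eq_bot_or_exists_atom_le (s.val j)).resolve_left hj
  -- The atom is the least family whose component at `j` lies above `a`. For `r < t`, the atom `a`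
  -- is not below `r.val j`, hence is below its complement; then `t ≤ rᶜ` and `r = ⊥`.
  obtain ⟨t, ht, htj⟩ := exists_isGLB {r : Sec D | a ≤ r.val j}
  have hat : a ≤ t.val j := (htj j).2 (by rintro _ ⟨r, hr, rfl⟩; exact hr)
  refine ⟨t, ⟨?_, fun r hr => ?_⟩, ht.1 has⟩
  · rintro rfl
    exact ha.1 (le_bot_iff.1 hat)
  · rcases atom_le_or_le_compl ha (r.val j) with h | h
    · exact (hr.not_ge (ht.1 h)).elim
    · have h1 : t ≤ rᶜ := ht.1 h
      exact le_bot_iff.1 ((le_inf le_rfl (hr.le.trans h1)).trans (inf_compl_self r).le)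

/-- The algebra of compatible families. -/
def cAlg (D : J ⥤ CAlg.{u}) : CAlg.{u} where
  alg := ⟨Sec D⟩
  complete S := (exists_isLUB S).imp fun _ h => h.1
  atomic := ⟨fun s => or_iff_not_imp_left.2 fun h => exists_atom_le h⟩
  additive S s h := by
    refine ⟨?_, fun t ht => le_iff.2 fun j => ((D.obj j).additive _ _ (isLUB_val h j)).2 ?_⟩
    · rintro _ ⟨r, hr, rfl⟩
      exact dia_mono (h.1 hr)
    · rintro _ ⟨_, ⟨r, hr, rfl⟩, rfl⟩
      exact le_iff.1 (ht ⟨r, hr, rfl⟩) j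

/-- The cone of projections. -/
def cone (D : J ⥤ CAlg.{u}) : Cone D where
  pt := cAlg D
  π :=
    { app := fun j => ⟨mkHom (A := (cAlg D).alg) (fun s : Sec D => s.val j) (fun _ _ => rfl)
          (fun _ _ => rfl) rfl rfl (fun _ => rfl),
        fun _ _ h => isLUB_val h j, fun _ _ h => isGLB_val h j⟩
      naturality := fun _ _ f => Subtype.ext (hom_ext fun s : Sec D => (s.compat f).symm) }

theorem cone_w (c : Cone D) {i j : J} (f : i ⟶ j) (b : c.pt.alg) :
    fn (D.map f).1 (fn (c.π.app i).1 b) = fn (c.π.app j).1 b :=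
  congrArg (fun k : c.pt ⟶ D.obj j => fn k.1 b) (c.w f)

/-- The comparison of a cone with the compatible families. -/
def ofCone (c : Cone D) : c.pt ⟶ (cone D).pt :=
  ⟨mkHom (B := (cAlg D).alg)
      (fun b => (⟨fun j => fn (c.π.app j).1 b, fun f => cone_w c f b⟩ : Sec D))
      (fun _ _ => Sec.ext fun _ => fn_sup _ _ _) (fun _ _ => Sec.ext fun _ => fn_inf _ _ _)
      (Sec.ext fun _ => fn_top _) (Sec.ext fun _ => fn_bot _)
      (fun _ => Sec.ext fun _ => fn_dia _ _), by
    constructor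
    · intro s a h
      refine ⟨?_, fun t ht => le_iff.2 fun j => ((c.π.app j).2.1 _ _ h).2 ?_⟩
      · rintro _ ⟨r, hr, rfl⟩
        exact fn_mono _ (h.1 hr)
      · rintro _ ⟨r, hr, rfl⟩
        exact le_iff.1 (ht ⟨r, hr, rfl⟩) j
    · intro s a h
      refine ⟨?_, fun t ht => le_iff.2 fun j => ((c.π.app j).2.2 _ _ h).2 ?_⟩
      · rintro _ ⟨r, hr, rfl⟩
        exact fn_mono _ (h.1 hr)
      · rintro _ ⟨r, hr, rfl⟩
        exact le_iff.1 (ht ⟨r, hr, rfl⟩) j⟩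

end Sec

variable {D}

/-- The projections of a limit cone are jointly injective. -/
theorem limit_elem_ext {c : Cone D} (hc : IsLimit c) {a b : c.pt.alg}
    (h : ∀ j, fn (c.π.app j).1 a = fn (c.π.app j).1 b) : a = b := by
  -- The comparison with compatible families remembers exactly the projections; a left inverse makes
  -- it injective.
  have e : Sec.ofCone c ≫ hc.lift (Sec.cone D) = 𝟙 c.pt := by
    refine hc.hom_ext fun j => ?_
    rw [Category.assoc, hc.fac, Category.id_comp]
    rfl
  have e' : ∀ x : c.pt.alg, fn (hc.lift (Sec.cone D)).1 (fn (Sec.ofCone c).1 x) = x := fun x =>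
    congrArg (fun k : c.pt ⟶ c.pt => fn k.1 x) e
  have hab : fn (Sec.ofCone c).1 a = fn (Sec.ofCone c).1 b := Sec.ext (D := D) h
  rw [← e' a, hab, e' b]

end Sections

/-! ### Complex algebras of locally finite frames are profinite -/

section Profinite

/-- The homomorphism of complex algebras dual to a bounded morphism. -/
def pullback {P Q : Frame.{u}} (f : P.carrier → Q.carrier)
    (forth : ∀ a b, P.R a b → Q.R (f a) (f b))
    (back : ∀ a q, Q.R (f a) q → ∃ b, P.R a b ∧ f b = q) : Q.complexAlg ⟶ P.complexAlg :=
  mkHom (A := Q.complexAlg) (B := P.complexAlg) (fun T => f ⁻¹' (pts T)) (fun _ _ => rfl)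
    (fun _ _ => rfl) rfl rfl (fun T => by
      apply Set.Subset.antisymm
      · rintro a ⟨q, hq, hT⟩
        obtain ⟨b, hb, rfl⟩ := back a q hq
        exact ⟨b, hb, hT⟩
      · rintro a ⟨b, hb, hT⟩
        exact ⟨f b, forth a b hb, hT⟩)

theorem pullback_preservesBounds {P Q : Frame.{u}} (f : P.carrier → Q.carrier)
    (forth : ∀ a b, P.R a b → Q.R (f a) (f b))
    (back : ∀ a q, Q.R (f a) q → ∃ b, P.R a b ∧ f b = q) :
    PreservesBounds (pullback f forth back) := by
  constructor
  · intro s T h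
    refine ⟨?_, fun c hc a ha => ?_⟩
    · rintro _ ⟨S, hS, rfl⟩
      exact fn_mono _ (h.1 hS)
    · obtain ⟨S, hS, hm⟩ := (isLUB_complex h (f a)).1 ha
      exact hc ⟨S, hS, rfl⟩ hm
  · intro s T h
    refine ⟨?_, fun c hc a ha => ?_⟩
    · rintro _ ⟨S, hS, rfl⟩
      exact fn_mono _ (h.1 hS)
    · exact (isGLB_complex h (f a)).2 fun S hS => hc ⟨S, hS, rfl⟩ ha

/-- The subframe on a set of points. -/
def subframe (P : Frame.{u}) (S : Set P.carrier) : Frame.{u} where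
  carrier := S
  R a b := P.R a b
  refl a := P.refl a
  trans a b c := P.trans a b c

/-- Restriction to a generated subframe. -/
def restrict (P : Frame.{u}) {S : Set P.carrier} (hS : P.Generated S) :
    P.complexAlg ⟶ (subframe P S).complexAlg :=
  pullback (P := subframe P S) (Q := P) Subtype.val (fun _ _ h => h)
    (fun a q h => ⟨⟨q, hS _ _ a.2 h⟩, h, rfl⟩)

theorem restrict_preservesBounds (P : Frame.{u}) {S : Set P.carrier} (hS : P.Generated S) :
    PreservesBounds (restrict P hS) := pullback_preservesBounds _ _ _

theorem finite_subframe_complexAlg (P : Frame.{u}) {S : Set P.carrier} (hS : S.Finite) :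
    Finite (subframe P S).complexAlg :=
  have : Finite S := hS
  inferInstanceAs (Finite (Set S))

/-- The finite generated subframes of a frame. -/
abbrev FinUp (P : Frame.{u}) : Type u := {S : Set P.carrier // S.Finite ∧ P.Generated S}

instance (P : Frame.{u}) : Nonempty (FinUp P) :=
  ⟨⟨∅, Set.finite_empty, fun _ _ h => h.elim⟩⟩

instance (P : Frame.{u}) : IsDirectedOrder (FinUp P) :=
  ⟨fun S T => ⟨⟨S.1 ∪ T.1, S.2.1.union T.2.1, fun p q hp h =>
    hp.imp (fun hp => S.2.2 p q hp h) (fun hp => T.2.2 p q hp h)⟩,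
    Set.subset_union_left, Set.subset_union_right⟩⟩

/-- The diagram of the complex algebras of the finite generated subframes. -/
def finUpDiagram (P : Frame.{u}) : (FinUp P)ᵒᵖ ⥤ CAlg.{u} where
  obj S := (subframe P S.unop.1).complexCAlg
  map {S T} f := ⟨pullback (P := subframe P T.unop.1) (Q := subframe P S.unop.1)
      (Set.inclusion (leOfHom f.unop)) (fun _ _ h => h)
      (fun a q h => ⟨⟨q.1, T.unop.2.2 _ _ a.2 h⟩, h, rfl⟩), pullback_preservesBounds _ _ _⟩
  map_id _ := rfl
  map_comp _ _ := rfl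

/-- The restrictions to finite generated subframes. -/
def finUpCone (P : Frame.{u}) : Cone (finUpDiagram P) where
  pt := P.complexCAlg
  π :=
    { app := fun S => ⟨restrict P S.unop.2.2, restrict_preservesBounds P _⟩
      naturality := fun _ _ _ => rfl }

variable {P : Frame.{u}}

/-- The finite generated subframe generated by a point. -/
def pointUp (hP : ∀ p, {q | P.R p q}.Finite) (p : P.carrier) : FinUp P :=
  ⟨{q | P.R p q}, hP p, fun a b ha h => P.trans p a b ha h⟩

/-- The set of points determined by an element of a cone over the finite generated subframes. -/
def glue (hP : ∀ p, {q | P.R p q}.Finite) (s : Cone (finUpDiagram P)) (b : s.pt.alg) :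
    P.complexAlg :=
  show Set P.carrier from {p | (⟨p, P.refl p⟩ : {q | P.R p q}) ∈
    pts (P := subframe P (pointUp hP p).1) (fn (s.π.app (Opposite.op (pointUp hP p))).1 b)}

/-- `S` contains the up-set of `p`, so compatibility of the cone lets membership of `p` be read off
on either subframe. -/
theorem mem_glue (hP : ∀ p, {q | P.R p q}.Finite) (s : Cone (finUpDiagram P)) (b : s.pt.alg)
    (S : FinUp P) (p : S.1) : p.1 ∈ pts (glue hP s b) ↔
      p ∈ pts (P := subframe P S.1) (fn (s.π.app (Opposite.op S)).1 b) := by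
  have hle : pointUp hP p.1 ≤ S := fun q hq => S.2.2 _ _ p.2 hq
  have h := Sec.cone_w s (homOfLE hle).op b
  exact (Set.ext_iff.1 h ⟨p.1, P.refl p.1⟩).symm

theorem restrict_glue (hP : ∀ p, {q | P.R p q}.Finite) (s : Cone (finUpDiagram P))
    (b : s.pt.alg) (S : FinUp P) :
    fn (restrict P S.2.2) (glue hP s b) = fn (s.π.app (Opposite.op S)).1 b :=
  Set.ext fun p => mem_glue hP s b S p

theorem eq_of_restrict (hP : ∀ p, {q | P.R p q}.Finite) {T T' : P.complexAlg}
    (h : ∀ S : FinUp P, fn (restrict P S.2.2) T = fn (restrict P S.2.2) T') : T = T' := by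
  refine Set.ext fun p => ?_
  exact Set.ext_iff.1 (h (pointUp hP p)) ⟨p, P.refl p⟩

theorem le_of_restrict (hP : ∀ p, {q | P.R p q}.Finite) {T T' : P.complexAlg}
    (h : ∀ S : FinUp P, fn (restrict P S.2.2) T ≤ fn (restrict P S.2.2) T') : T ≤ T' :=
  fun p hp => h (pointUp hP p) (show (⟨p, P.refl p⟩ : {q | P.R p q}) ∈ _ from hp)

/-- The morphism induced by a cone over the finite generated subframes. -/
def glueHom (hP : ∀ p, {q | P.R p q}.Finite) (s : Cone (finUpDiagram P)) :
    s.pt ⟶ P.complexCAlg :=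
  ⟨mkHom (A := s.pt.alg) (B := P.complexAlg) (glue hP s)
    (fun a b => eq_of_restrict hP fun S => by
      simp only [fn_sup, restrict_glue]; rfl)
    (fun a b => eq_of_restrict hP fun S => by
      simp only [fn_inf, restrict_glue]; rfl)
    (eq_of_restrict hP fun S => by simp only [fn_top, restrict_glue]; rfl)
    (eq_of_restrict hP fun S => by simp only [fn_bot, restrict_glue]; rfl)
    (fun a => eq_of_restrict hP fun S => by
      simp only [fn_dia, restrict_glue]; rfl), by
    constructor
    · intro t a h
      refine ⟨?_, fun c hc => le_of_restrict hP fun S => ?_⟩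
      · rintro _ ⟨b, hb, rfl⟩
        exact fn_mono _ (h.1 hb)
      · refine (restrict_glue hP s a S).le.trans (((s.π.app _).2.1 _ _ h).2 ?_)
        rintro _ ⟨b, hb, rfl⟩
        exact (restrict_glue hP s b S).ge.trans (fn_mono _ (hc ⟨b, hb, rfl⟩))
    · intro t a h
      refine ⟨?_, fun c hc => le_of_restrict hP fun S => ?_⟩
      · rintro _ ⟨b, hb, rfl⟩
        exact fn_mono _ (h.1 hb)
      · refine le_trans (((s.π.app (Opposite.op S)).2.2 _ _ h).2 ?_) (restrict_glue hP s a S).ge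
        rintro _ ⟨b, hb, rfl⟩
        exact (fn_mono _ (hc ⟨b, hb, rfl⟩)).trans (restrict_glue hP s b S).le⟩

/-- A frame with finite up-sets of points is the directed union of its finite generated subframes,
so subsets of it are compatible families of subsets of these. -/
theorem isProfinite_complexCAlg (hP : ∀ p, {q | P.R p q}.Finite) :
    P.complexCAlg.IsProfinite := by
  refine ⟨(FinUp P)ᵒᵖ, inferInstance, inferInstance, finUpDiagram P, finUpCone P, fun S =>
    finite_subframe_complexAlg P S.unop.2.1, ⟨?_⟩, ⟨Iso.refl _⟩⟩
  exact
    { lift := fun s => glueHom hP s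
      fac := fun s S => Subtype.ext (hom_ext fun b => restrict_glue hP s b S.unop)
      uniq := fun s m hm => Subtype.ext (hom_ext fun b => eq_of_restrict hP fun S =>
        (congrArg (fun k : s.pt ⟶ (finUpDiagram P).obj (Opposite.op S) => fn k.1 b)
          (hm (Opposite.op S))).trans (restrict_glue hP s b S).symm) }

end Profinite

/-! ### Finite quotients and the profinite completion -/

section Completion

/-- The quotient by a finite congruence, as an object of `S4`. -/
def quo {A : Alg.{u}} (θ : FinCon A) : Alg.{u} := ⟨θ.Quo⟩

instance {A : Alg.{u}} (θ : FinCon A) : Finite (quo θ) := θ.finite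

/-- The projection of an algebra to a quotient. -/
def quoMk {A : Alg.{u}} (θ : FinCon A) : A ⟶ quo θ :=
  mkHom (B := quo θ) θ.cls (fun _ _ => rfl) (fun _ _ => rfl) rfl rfl (fun _ => rfl)

/-- The projection between quotients by comparable congruences. -/
def quoMap {A : Alg.{u}} {θ ψ : FinCon A} (h : ∀ a b : A, θ.r a b → ψ.r a b) : quo θ ⟶ quo ψ :=
  mkHom (A := quo θ) (B := quo ψ)
    (Quotient.lift ψ.cls fun a b k => Quotient.sound (h a b k))
    (by rintro ⟨a⟩ ⟨b⟩; rfl) (by rintro ⟨a⟩ ⟨b⟩; rfl) rfl rfl (by rintro ⟨a⟩; rfl)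

/-- The kernel of a homomorphism to a finite algebra. -/
def kerCon {A B : Alg.{u}} [Finite B] (f : A ⟶ B) : FinCon A where
  toSetoid := Setoid.ker (fn f)
  sup {a b c d} h k := by
    change fn f _ = fn f _
    rw [fn_sup, fn_sup, show fn f a = fn f b from h, show fn f c = fn f d from k]
  inf {a b c d} h k := by
    change fn f _ = fn f _
    rw [fn_inf, fn_inf, show fn f a = fn f b from h, show fn f c = fn f d from k]
  compl {a b} h := by
    change fn f _ = fn f _
    rw [fn_compl, fn_compl, show fn f a = fn f b from h]
  dia {a b} h := by
    change fn f _ = fn f _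
    rw [fn_dia, fn_dia, show fn f a = fn f b from h]
  finite := Finite.of_injective (Quotient.lift (fn f) fun _ _ h => h)
    (by rintro ⟨a⟩ ⟨b⟩ h; exact Quotient.sound h)

/-- The embedding of the quotient by the kernel. -/
def kerLift {A B : Alg.{u}} [Finite B] (f : A ⟶ B) : quo (kerCon f) ⟶ B :=
  mkHom (A := quo (kerCon f)) (Quotient.lift (fn f) fun _ _ h => h)
    (by rintro ⟨a⟩ ⟨b⟩; exact fn_sup f a b) (by rintro ⟨a⟩ ⟨b⟩; exact fn_inf f a b)
    (fn_top f) (fn_bot f) (by rintro ⟨a⟩; exact fn_dia f a)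

theorem PreservesBounds.comp {A B C : Alg.{u}} {f : A ⟶ B} {g : B ⟶ C} (hf : PreservesBounds f)
    (hg : PreservesBounds g) : PreservesBounds (f ≫ g) := by
  constructor <;> intro s a h <;> rw [fn_comp, Set.image_comp]
  · exact hg.1 _ _ (hf.1 _ _ h)
  · exact hg.2 _ _ (hf.2 _ _ h)

/-- A bijective homomorphism is an isomorphism. -/
theorem exists_iso_of_bijective {A B : Alg.{u}} (f : A ⟶ B) (hf : Function.Bijective (fn f)) :
    ∃ e : A ≅ B, e.hom = f := by
  obtain ⟨g, hgf, hfg⟩ := Function.bijective_iff_has_inverse.1 hf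
  refine ⟨⟨f, mkHom g (fun a b => hf.1 ?_) (fun a b => hf.1 ?_) (hf.1 ?_) (hf.1 ?_)
    (fun a => hf.1 ?_), hom_ext hgf, hom_ext hfg⟩, rfl⟩
  · rw [fn_sup, hfg, hfg, hfg]
  · rw [fn_inf, hfg, hfg, hfg]
  · rw [fn_top, hfg]
  · rw [fn_bot, hfg]
  · rw [fn_dia, hfg, hfg]

variable {X : Type u}

/-- The canonical homomorphism to the complex algebra of the universal model. -/
abbrev eta (X : Type u) : Free X ⟶ (universalModel X).complexAlg := toUniversal X

theorem hom_unique {B : Alg.{u}} [Finite B] {g g' : (universalModel X).complexAlg ⟶ B}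
    (hg : PreservesBounds g) (hg' : PreservesBounds g')
    (h : ∀ a, fn g (fn (eta X) a) = fn g' (fn (eta X) a)) : g = g' :=
  extension_unique hg hg' fun x => h (Free.of x)

theorem exists_hom {B : Alg.{u}} [Finite B] (h : Free X ⟶ B) :
    ∃ g : (universalModel X).complexAlg ⟶ B, PreservesBounds g ∧
      (∀ a, fn g (fn (eta X) a) = fn h a) ∧
      ∃ S : Set (Points X), S.Finite ∧ (universalModel X).Generated S ∧ fn g S = ⊤ := by
  obtain ⟨g, hg, hx, hS⟩ := exists_extension fun x => fn h (Free.of x)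
  have e : eta X ≫ g = h := Free.hom_ext _ _ hx
  exact ⟨g, hg, fun a => congrArg (fun k : Free X ⟶ B => fn k a) e, hS⟩

/-! ### Comparison with the inverse limit of the finite quotients -/

/-- The extension of the projection to a finite quotient. -/
noncomputable def quoExt (θ : FinCon (Free X)) : (universalModel X).complexAlg ⟶ quo θ :=
  (exists_hom (quoMk θ)).choose

theorem quoExt_preservesBounds (θ : FinCon (Free X)) : PreservesBounds (quoExt θ) :=
  (exists_hom (quoMk θ)).choose_spec.1

theorem quoExt_eta (θ : FinCon (Free X)) (a : Free X) : fn (quoExt θ) (fn (eta X) a) = θ.cls a :=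
  (exists_hom (quoMk θ)).choose_spec.2.1 a

theorem exists_support (θ : FinCon (Free X)) : ∃ S : Set (Points X), S.Finite ∧
    (universalModel X).Generated S ∧ fn (quoExt θ) S = ⊤ :=
  (exists_hom (quoMk θ)).choose_spec.2.2

/-- Both sides extend the projection to the quotient by `ψ`, so `hom_unique` applies. This makes the
values of the `quoExt` a compatible family. -/
theorem quoExt_comp_quoMap {θ ψ : FinCon (Free X)} (h : ∀ a b : Free X, θ.r a b → ψ.r a b) :
    quoExt θ ≫ quoMap h = quoExt ψ :=
  hom_unique ((quoExt_preservesBounds θ).comp (preservesBounds_of_finite _)) (quoExt_preservesBounds ψ)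
    fun a => by
      rw [fn_comp, Function.comp_apply, quoExt_eta, quoExt_eta]
      rfl

/-- The comparison with the inverse limit of the finite quotients. -/
noncomputable def toPrC (X : Type u) : (universalModel X).complexAlg ⟶ PrC (Free X) :=
  mkHom (B := PrC (Free X))
    (fun T => (⟨fun θ => fn (quoExt θ) T, fun θ ψ h a ha => by
      rw [← quoExt_comp_quoMap h, fn_comp, Function.comp_apply, ha]
      rfl⟩ : PrCCarrier (Free X)))
    (fun _ _ => PrCCarrier.ext fun _ => fn_sup _ _ _)
    (fun _ _ => PrCCarrier.ext fun _ => fn_inf _ _ _)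
    (PrCCarrier.ext fun _ => fn_top _) (PrCCarrier.ext fun _ => fn_bot _)
    (fun _ => PrCCarrier.ext fun _ => fn_dia _ _)

theorem eta_toPrC : eta X ≫ toPrC X = PrC.unit (Free X) :=
  hom_ext fun a => PrCCarrier.ext fun θ => quoExt_eta θ a

variable (S : FinUp (universalModel X).toFrame)

instance : Finite (subframe (universalModel X).toFrame S.1).complexAlg :=
  finite_subframe_complexAlg _ S.2.1

/-- The congruence of having equal interpretations on a finite generated subframe. -/
abbrev conOf : FinCon (Free X) := kerCon (eta X ≫ restrict (universalModel X).toFrame S.2.2)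

theorem quoExt_kerLift : quoExt (conOf S) ≫ kerLift (eta X ≫ restrict (universalModel X).toFrame S.2.2) =
    restrict (universalModel X).toFrame S.2.2 :=
  hom_unique ((quoExt_preservesBounds _).comp (preservesBounds_of_finite _))
    (restrict_preservesBounds _ _) fun a => by
      rw [fn_comp, Function.comp_apply, quoExt_eta]
      rfl

/-- By `quoExt_kerLift`, the component at `conOf S` determines the restriction to `S`, and these
restrictions jointly separate subsets. -/
theorem toPrC_injective : Function.Injective (fn (toPrC X)) := by
  intro T T' h
  refine eq_of_restrict finite_unionRel fun S => ?_
  rw [← quoExt_kerLift S, fn_comp, Function.comp_apply, Function.comp_apply]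
  exact congrArg _ (congrArg (fun f : PrCCarrier (Free X) => f.val (conOf S)) h)

theorem conOf_iff (a b : Free X) : (conOf S).r a b ↔
    ∀ p ∈ S.1, p ∈ pts (fn (eta X) a) ↔ p ∈ pts (fn (eta X) b) := by
  constructor
  · exact fun h p hp => Set.ext_iff.1 (show fn (restrict (universalModel X).toFrame S.2.2)
      (fn (eta X) a) = fn (restrict (universalModel X).toFrame S.2.2) (fn (eta X) b) from h) ⟨p, hp⟩
  · exact fun h => Set.ext fun p => h p.1 p.2

/-- `quoExt θ` sends `S` to `⊤`, so intersecting with `S` does not change the value. -/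
theorem quoExt_congr {θ : FinCon (Free X)} {S : Set (Points X)} (hS : fn (quoExt θ) S = ⊤)
    {T T' : (universalModel X).complexAlg} (h : ∀ p ∈ S, p ∈ pts T ↔ p ∈ pts T') :
    fn (quoExt θ) T = fn (quoExt θ) T' := by
  have key : ∀ T : (universalModel X).complexAlg, fn (quoExt θ) T = fn (quoExt θ)
      (T ⊓ (show (universalModel X).complexAlg from S)) := fun T => by
    rw [fn_inf]
    exact (inf_eq_left.2 (le_top.trans hS.ge)).symm
  rw [key T, key T']
  exact congrArg _ (Set.ext fun p => and_congr_left (h p))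

theorem toPrC_surjective : Function.Surjective (fn (toPrC X)) := by
  intro (f : PrCCarrier (Free X))
  let U : Points X → FinUp (universalModel X).toFrame :=
    pointUp (P := (universalModel X).toFrame) finite_unionRel
  -- Membership of `p` is decided by the component of `f` at the congruence of the up-set of `p`,
  -- through any representative of that component.
  let T : Set (Points X) := {p | ∃ a, f.val (conOf (U p)) = (conOf (U p)).cls a ∧
    p ∈ pts (fn (eta X) a)}
  refine ⟨T, PrCCarrier.ext fun θ => ?_⟩
  change fn (quoExt θ) T = f.val θ
  obtain ⟨S, hfin, hgen, hS⟩ := exists_support θ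
  let S' : FinUp (universalModel X).toFrame := ⟨S, hfin, hgen⟩
  -- One representative serves all of `S`: `conOf S'` refines both `θ` and the congruence of the
  -- up-set of each point of `S`, so `T` and `fn (eta X) a` agree on `S`.
  obtain ⟨a, ha⟩ := Quotient.exists_rep (f.val (conOf S'))
  have hθ : ∀ b c : Free X, (conOf S').r b c → θ.r b c := fun b c h => by
    have h1 := quoExt_congr hS ((conOf_iff S' b c).1 h)
    rw [quoExt_eta, quoExt_eta] at h1
    exact Quotient.exact h1
  rw [f.compat _ θ hθ a ha.symm, ← quoExt_eta]
  refine quoExt_congr hS fun p hp => ?_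
  have hp' : f.val (conOf (U p)) = (conOf (U p)).cls a := by
    refine f.compat (conOf S') _ (fun b c h => ?_) a ha.symm
    exact (conOf_iff _ b c).2 fun q hq => (conOf_iff S' b c).1 h q (hgen p q hp hq)
  constructor
  · rintro ⟨b, hb, hm⟩
    have h1 : (conOf (U p)).r a b := Quotient.exact (hp'.symm.trans hb)
    exact ((conOf_iff _ a b).1 h1 p (unionRel_refl p)).2 hm
  · exact fun hm => ⟨a, hp', hm⟩

theorem isProfiniteReflection_toUniversal (X : Type u) :
    IsProfiniteReflection (T := (universalModel X).complexCAlg) (toUniversal X) := by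
  refine ⟨isProfinite_complexCAlg finite_unionRel, ?_⟩
  rintro B ⟨J, _, _, D, c, hfin, ⟨hc⟩, ⟨i⟩⟩ h
  -- It suffices to treat the limit point itself, the isomorphism with `B` being composed at the
  -- end. The extensions to the finite `D.obj j` form a cone by `hom_unique`, and equality in the
  -- limit is tested on projections.
  have lift_c : ∀ k : Free X ⟶ c.pt.alg, ∃ g : (universalModel X).complexCAlg ⟶ c.pt,
      ∀ a, fn g.1 (fn (eta X) a) = fn k a := by
    intro k
    choose g hg hga _ using fun j =>
      have := hfin j
      exists_hom (k ≫ (c.π.app j).1)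
    let s : Cone D :=
      { pt := (universalModel X).complexCAlg
        π :=
          { app := fun j => ⟨g j, hg j⟩
            naturality := fun j j' f => Subtype.ext (by
              have := hfin j'
              refine hom_unique (hg j') ((hg j).comp (D.map f).2) fun a => ?_
              exact (hga j' a).trans ((Sec.cone_w c f (fn k a)).symm.trans
                (congrArg (fn (D.map f).1) (hga j a).symm))) } }
    refine ⟨hc.lift s, fun a => limit_elem_ext hc fun j => ?_⟩
    refine Eq.trans ?_ (hga j a)
    exact congrArg (fun m : s.pt ⟶ D.obj j => fn m.1 (fn (eta X) a)) (hc.fac s j)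
  have unique_c : ∀ g g' : (universalModel X).complexCAlg ⟶ c.pt,
      (∀ a, fn g.1 (fn (eta X) a) = fn g'.1 (fn (eta X) a)) → g = g' := fun g g' hgg =>
    hc.hom_ext fun j => Subtype.ext (by
      have := hfin j
      exact hom_unique (g ≫ c.π.app j).2 (g' ≫ c.π.app j).2 fun a =>
        congrArg (fn (c.π.app j).1) (hgg a))
  obtain ⟨g, hg⟩ := lift_c (h ≫ i.inv.1)
  refine ⟨g ≫ i.hom, hom_ext fun a => ?_, fun g' hg' => ?_⟩
  · refine (congrArg (fn i.hom.1) (hg a)).trans ?_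
    exact congrArg (fun m : B ⟶ B => fn m.1 (fn h a)) i.inv_hom_id
  · rw [← Iso.comp_inv_eq]
    refine unique_c _ _ fun a => Eq.trans ?_ (hg a).symm
    exact congrArg (fun m : Free X ⟶ B.alg => fn i.inv.1 (fn m a)) hg'

end Completion

end S4

theorem mainTheorem8 (X : Type u) :
    (∃ e : S4.PrC (S4.Free X) ≅ (S4.universalModel X).complexAlg,
        S4.PrC.unit (S4.Free X) ≫ e.hom = S4.toUniversal X) ∧
      S4.IsProfiniteReflection (T := (S4.universalModel X).complexCAlg) (S4.toUniversal X) := by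
  refine ⟨?_, S4.isProfiniteReflection_toUniversal X⟩
  obtain ⟨e, he⟩ := S4.exists_iso_of_bijective (S4.toPrC X)
    ⟨S4.toPrC_injective, S4.toPrC_surjective⟩
  refine ⟨e.symm, ?_⟩
  exact (Iso.comp_inv_eq e).2 (by rw [he]; exact S4.eta_toPrC.symm)
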